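/- Let $\mathbb T=\mathbb R/\mathbb Z$ with Lebesgue measure $m$ ($m(\mathbb T)=1$), and let $\mathcal M_1$ be the set of Borel probability measures on $\mathbb T$. Let $f:\mathbb T\to\mathbb T$ be $C^2$ with $|f'|\ge\sigma>1$ and $f(0)=0$, and let $\bar\mu$ be its absolutely continuous invariant probability measure. Let $\phi,\psi:\mathbb T\to\mathbb R$ be $C^2$ with $\phi(0)=0$, and let $\alpha\in\mathbb R$ satisfy $$\Big|f'(0)\Big(1+\alpha\,\phi'(0)\int\psi\,d\bar\mu\Big)\Big|<1 .$$ For $h_{11},h_{12}\in C^2(\mathbb T\times\mathbb T,\mathbb R)$ with $h_{11}(0,y)=h_{12}(0,y)=0$ for all $y$, and for $\epsilon\in\mathbb R$, define for $(\mu,\nu)\in\mathcal M_1^2$ $$F_{(\mu,\nu),1}(x)=f\Big(x+\epsilon\int h_{11}(x,y)\,d\mu(y)+\epsilon\int h_{12}(x,y)\,d\nu(y)\Big),\qquad F_{(\mu,\nu),2}(x)=f\Big(x+\alpha\phi(x)\int\psi\,d\mu\Big),$$ and $\mathcal F_\epsilon(\mu,\nu)=\big((F_{(\mu,\nu),1})_*\mu,\,(F_{(\mu,\nu),2})_*\nu\big)$.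 For $K,r>0$ let $\mathcal N_{K,r}$ be the set of $\mu\in\mathcal M_1$ with a $C^1$ density $\rho$ such that $\int|\rho'|\,dm+\int|\rho|\,dm\le K$ and $|\mu-\bar\mu|_{L^1}<r$, where $|\cdot|_{L^1}$ is the $L^1(m)$ distance of densities. Let $d_W$ be the Wasserstein distance on $\mathcal M_1$, extended to $\mathcal M_1^2$ by the maximum over the two components, and let $\mathcal{PS}_{\{0\}}=\mathcal M_1\times\{\delta_0\}$. For $\nu\in\mathcal M_1$ let $|\operatorname{supp}\nu|$ be the infimum of the lengths of the arcs containing $\operatorname{supp}\nu$. Then, for $\epsilon$ small enough, $(\bar\mu,\delta_0)$ is a stable partially synchronized state of $\mathcal F_\epsilon$. Precisely, there are $K_0,\delta_1,\eta,R>0$ such that for all $h_{11},h_{12}$ as above, all $K\ge K_0$ and all $\delta\in(0,\delta_1]$ there is $\epsilon_0>0$ such that for all $|\epsilon|<\epsilon_0$: 1. $\bar\mu\in\mathcal N_{K,\delta/2}$, and for every $\mu\in\mathcal N_{K,\delta/2}$ and every $\nu\in\mathcal M_1$ with $|\operatorname{supp}\nu|<\eta$ and $\operatorname{supp}\nu\subset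 B_R(0)$, $$\lim_{n\to\infty} d_W\big(\mathcal F_\epsilon^n(\mu,\nu),\,\mathcal{PS}_{\{0\}}\big)=0;$$ 2. for every $\mu\in\mathcal N_{K,\delta/2}$, every $\nu\in\mathcal M_1$ and every $n\ge 0$, the first component of $\mathcal F_\epsilon^n(\mu,\nu)$ lies in $\mathcal N_{K,\delta}$. -/

import Mathlib

open MeasureTheory Set Filter Topology
open scoped ENNReal

namespace ClusterSync

/-- The circle `ℝ / ℤ`, with its arc-length metric and Lebesgue measure of total mass one. -/
abbrev Circ : Type := UnitAddCircle

/-- `F : ℝ → ℝ` is a lift of class `C²` of the circle map `f`. The derivative of `f` at the class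
of `t` is then `deriv F t`. -/
def IsC2Lift (f : Circ → Circ) (F : ℝ → ℝ) : Prop :=
  ContDiff ℝ 2 F ∧ ∀ t : ℝ, f (t : Circ) = ((F t : ℝ) : Circ)

/-- A real function on the circle is `C²`. -/
def IsC2 (g : Circ → ℝ) : Prop :=
  ContDiff ℝ 2 (fun t : ℝ => g (t : Circ))

/-- A real function on the two-torus is `C²`, jointly in both variables. -/
def IsC2₂ (h : Circ → Circ → ℝ) : Prop :=
  ContDiff ℝ 2 (fun p : ℝ × ℝ => h (p.1 : Circ) (p.2 : Circ))

/-- The data of a network of two clusters: uncoupled maps `fᵢ` and interaction functions `hᵢⱼ`. -/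
structure Network where
  f₁ : Circ → Circ
  f₂ : Circ → Circ
  h₁₁ : Circ → Circ → ℝ
  h₁₂ : Circ → Circ → ℝ
  h₂₁ : Circ → Circ → ℝ
  h₂₂ : Circ → Circ → ℝ

/-- A pair of measures on the circle; it is a state of the network when both are probability
measures. -/
abbrev State : Type := Measure Circ × Measure Circ

/-- The map `x ↦ f₁ (x + ∫ h₁₁(x,y) dμ(y) + ∫ h₁₂(x,y) dν(y))` driving cluster 1 at the state
`s = (μ, ν)`. -/
noncomputable def Network.map₁ (net : Network) (s : State) (x : Circ) : Circ :=
  net.f₁ (x + ((∫ y, net.h₁₁ x y ∂s.1 + ∫ y, net.h₁₂ x y ∂s.2 : ℝ) : Circ))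

/-- The map `x ↦ f₂ (x + ∫ h₂₁(x,y) dμ(y) + ∫ h₂₂(x,y) dν(y))` driving cluster 2 at the state
`s = (μ, ν)`. -/
noncomputable def Network.map₂ (net : Network) (s : State) (x : Circ) : Circ :=
  net.f₂ (x + ((∫ y, net.h₂₁ x y ∂s.1 + ∫ y, net.h₂₂ x y ∂s.2 : ℝ) : Circ))

/-- The self-consistent transfer operator. -/
noncomputable def Network.step (net : Network) (s : State) : State :=
  (s.1.map (net.map₁ s), s.2.map (net.map₂ s))

/-- The Wasserstein distance between two measures on the circle, as a supremum over functions
with Lipschitz constant at most one. -/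
noncomputable def dW (μ ν : Measure Circ) : ℝ≥0∞ :=
  ⨆ (g : Circ → ℝ) (_ : LipschitzWith 1 g), ENNReal.ofReal (∫ x, g x ∂μ - ∫ x, g x ∂ν)

/-- The Wasserstein distance between two states. -/
noncomputable def State.dW (s t : State) : ℝ≥0∞ :=
  max (ClusterSync.dW s.1 t.1) (ClusterSync.dW s.2 t.2)

/-- The distance of a state from a set of states. -/
noncomputable def State.dWSet (s : State) (A : Set State) : ℝ≥0∞ :=
  ⨅ t ∈ A, s.dW t

/-- The partially synchronized states whose second cluster is a Dirac mass at a point of `X`. -/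
def partiallySynchronized (X : Set Circ) : Set State :=
  {s | IsProbabilityMeasure s.1 ∧ ∃ x ∈ X, s.2 = Measure.dirac x}

/-- The infimum of the lengths of the arcs containing `S`. -/
noncomputable def arcLength (S : Set Circ) : ℝ :=
  sInf {l : ℝ | ∃ a b : ℝ, a ≤ b ∧ b ≤ a + 1 ∧
    S ⊆ (fun t : ℝ => (t : Circ)) '' Icc a b ∧ l = b - a}

/-- The state `s` is a stable partially synchronized state (synchronized in `X`), with set `𝒩` of
allowed perturbations of its first cluster and with tolerances `η` and `R` for the perturbations
of its second cluster: every perturbed state converges to the partially synchronized states. -/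
def IsStableWith (net : Network) (X : Set Circ) (𝒩 : Set (Measure Circ)) (η R : ℝ)
    (s : State) : Prop :=
  0 < η ∧ 0 < R ∧ s ∈ partiallySynchronized X ∧ s.1 ∈ 𝒩 ∧
  ∀ μ' ν' : Measure Circ, IsProbabilityMeasure μ' → IsProbabilityMeasure ν' → μ' ∈ 𝒩 →
    arcLength ν'.support < η → ν'.support ⊆ Metric.thickening R X →
    Tendsto (fun n : ℕ => State.dWSet (net.step^[n] (μ', ν')) (partiallySynchronized X))
      atTop (𝓝 0)

/-- `ρ` is a nonnegative `C¹` density of `μ` with respect to Lebesgue measure. -/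
def IsC1Density (ρ : Circ → ℝ) (μ : Measure Circ) : Prop :=
  ContDiff ℝ 1 (fun t : ℝ => ρ (t : Circ)) ∧ (∀ x, 0 ≤ ρ x) ∧
    μ = volume.withDensity (fun x => ENNReal.ofReal (ρ x))

/-- The strong norm `∫ |ρ'| + ∫ |ρ|` of a `C¹` density. -/
noncomputable def strongNorm (ρ : Circ → ℝ) : ℝ :=
  (∫ t in (0 : ℝ)..1, |deriv (fun u : ℝ => ρ (u : Circ)) t|) + ∫ x, |ρ x|

/-- The `L¹` distance between the densities of two absolutely continuous measures. -/
noncomputable def l1Dist (μ ν : Measure Circ) : ℝ :=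
  ∫ x, |(μ.rnDeriv volume x).toReal - (ν.rnDeriv volume x).toReal|

/-- The probability measures with a `C¹` density whose strong norm is at most `K` and whose `L¹`
distance from `m` is less than `r`. -/
def c1Ball (m : Measure Circ) (K r : ℝ) : Set (Measure Circ) :=
  {μ | IsProbabilityMeasure μ ∧ (∃ ρ, IsC1Density ρ μ ∧ strongNorm ρ ≤ K) ∧ l1Dist μ m < r}

/-- The example network with small interactions added to cluster 1: both uncoupled maps are `f`,
`h₁ⱼ` is replaced by `ε h₁ⱼ`, `h₂₁(x,y) = α φ(x) ψ(y)` and `h₂₂ = 0`. -/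
def perturbedExample (f : Circ → Circ) (φ ψ : Circ → ℝ) (α : ℝ) (h₁₁ h₁₂ : Circ → Circ → ℝ)
    (ε : ℝ) : Network where
  f₁ := f
  f₂ := f
  h₁₁ x y := ε * h₁₁ x y
  h₁₂ x y := ε * h₁₂ x y
  h₂₁ x y := α * (φ x * ψ y)
  h₂₂ _ _ := 0

end ClusterSync

/-! The two clusters obey different mechanisms, linked only through the mean of `ψ`. If that mean is
within `d` of its value at the invariant measure, the map driving the second cluster contracts a
fixed ball about 0 by a factor `κ < 1` (`exists_contraction`). It therefore suffices to keep the
first cluster `L¹`-close to the invariant density for all time.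

The first cluster is driven by `f` composed with a degree one map that is `C²`-close to the
identity, uniformly in the state (`exists_nearId_of_interaction`). On densities one step is
`c.transfer ∘ b.transfer`. The Lasota–Yorke inequality makes a class of densities with variation at
most `V` invariant under all these operators (`Bounds.dens_perturbed`), and on this class
`b.transfer` moves a density by `O(ε)` in `L¹`. The true orbit is thus a pseudo-orbit of the
unperturbed operator. Since `N` unperturbed steps bring the whole class within `δ / 4` of the
invariant density, the orbit can be compared with a fresh unperturbed orbit started `N` steps
earlier, and errors never accumulate (`l1_pseudoOrbit_lt`).

The uniform convergence is a Doeblin argument (`Bounds.exists_l1_decay`): a density of bounded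
variation is at least `1 / 2` on some interval, expansion stretches the interval over the circle,
and a constant common to any two images can then be subtracted. The same decay, upgraded to `C¹`,
constructs a `C¹` invariant density, and approximation in `L¹` shows that the given absolutely
continuous invariant measure has that density. -/

namespace ClusterSync

/-! ### Covers of the circle and their transfer operators on periodic functions. -/

/-- A `C²` lift of a covering map of the circle, with its inverse, orientation and degree. -/
structure CircleCover where
  map : ℝ → ℝ
  inv : ℝ → ℝ
  sgn : ℝ
  deg : ℕ
  sgn_eq : sgn = 1 ∨ sgn = -1
  contDiff : ContDiff ℝ 2 map
  map_inv : ∀ t, map (inv t) = t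
  inv_map : ∀ t, inv (map t) = t
  continuous_inv : Continuous inv
  map_add_one : ∀ t, map (t + 1) = map t + sgn * deg
  deriv_pos : ∀ t, 0 < sgn * deriv map t

/-- The `L¹` norm of a periodic function. -/
noncomputable def l1 (u : ℝ → ℝ) : ℝ := ∫ t in (0 : ℝ)..1, |u t|

/-- Periodic functions of class `C¹`. -/
def C1Per (u : ℝ → ℝ) : Prop := ContDiff ℝ 1 u ∧ Function.Periodic u 1

lemma C1Per.continuous {u : ℝ → ℝ} (hu : C1Per u) : Continuous u := hu.1.continuous

lemma C1Per.differentiable {u : ℝ → ℝ} (hu : C1Per u) : Differentiable ℝ u :=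
  hu.1.differentiable (by norm_num)

lemma C1Per.continuous_deriv {u : ℝ → ℝ} (hu : C1Per u) : Continuous (deriv u) :=
  hu.1.continuous_deriv (by norm_num)

lemma periodic_deriv {u : ℝ → ℝ} (hu : Function.Periodic u 1) : Function.Periodic (deriv u) 1 := by
  intro t
  rw [← deriv_comp_add_const, funext hu]

lemma C1Per.const (c : ℝ) : C1Per (fun _ => c) := ⟨contDiff_const, fun _ => rfl⟩

lemma C1Per.sub {u v : ℝ → ℝ} (hu : C1Per u) (hv : C1Per v) : C1Per (fun t => u t - v t) :=
  ⟨hu.1.sub hv.1, hu.2.sub hv.2⟩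

lemma C1Per.add {u v : ℝ → ℝ} (hu : C1Per u) (hv : C1Per v) : C1Per (fun t => u t + v t) :=
  ⟨hu.1.add hv.1, hu.2.add hv.2⟩

lemma C1Per.const_mul {u : ℝ → ℝ} (c : ℝ) (hu : C1Per u) : C1Per (fun t => c * u t) :=
  ⟨contDiff_const.mul hu.1, fun t => by simp only [hu.2 t]⟩

lemma l1_nonneg (u : ℝ → ℝ) : 0 ≤ l1 u :=
  intervalIntegral.integral_nonneg (by norm_num) fun _ _ => abs_nonneg _

lemma l1_const_mul (c : ℝ) (u : ℝ → ℝ) : l1 (fun t => c * u t) = |c| * l1 u := by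
  simp [l1, abs_mul]

lemma l1_mono {u v : ℝ → ℝ} (hu : Continuous u) (hv : Continuous v) (h : ∀ t, |u t| ≤ v t) :
    l1 u ≤ ∫ t in (0 : ℝ)..1, v t :=
  intervalIntegral.integral_mono_on (by norm_num) (hu.abs.intervalIntegrable _ _)
    (hv.intervalIntegrable _ _) fun t _ => h t

lemma l1_add_le {u v : ℝ → ℝ} (hu : Continuous u) (hv : Continuous v) :
    l1 (fun t => u t + v t) ≤ l1 u + l1 v := by
  refine (l1_mono (v := fun t => |u t| + |v t|) (hu.add hv) (hu.abs.add hv.abs)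
    fun t => abs_add_le _ _).trans ?_
  rw [intervalIntegral.integral_add (hu.abs.intervalIntegrable _ _) (hv.abs.intervalIntegrable _ _)]
  rfl

lemma l1_sub_le {u v w : ℝ → ℝ} (hu : Continuous u) (hv : Continuous v) (hw : Continuous w) :
    l1 (fun t => u t - w t) ≤ l1 (fun t => u t - v t) + l1 (fun t => v t - w t) := by
  simpa using l1_add_le (u := fun t => u t - v t) (v := fun t => v t - w t) (hu.sub hv) (hv.sub hw)

lemma abs_integral_le_l1 (u : ℝ → ℝ) : |∫ t in (0 : ℝ)..1, u t| ≤ l1 u :=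
  intervalIntegral.abs_integral_le_integral_abs (by norm_num)

lemma exists_bound_of_periodic {u : ℝ → ℝ} (hu : Continuous u)
    (hp : Function.Periodic u 1) : ∃ C, 0 < C ∧ ∀ t, |u t| ≤ C := by
  obtain ⟨C, hC⟩ := (isCompact_Icc (a := (0 : ℝ)) (b := 1)).exists_bound_of_continuousOn
    hu.continuousOn
  refine ⟨max C 1, by positivity, fun t => ?_⟩
  obtain ⟨y, hy, hy'⟩ := hp.exists_mem_Ico₀ one_pos t
  rw [hy']
  exact (hC y ⟨hy.1, hy.2.le⟩).trans (le_max_left _ _)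

namespace CircleCover

variable (c : CircleCover)

lemma sgn_mul_self : c.sgn * c.sgn = 1 := by rcases c.sgn_eq with h | h <;> rw [h] <;> norm_num

lemma abs_sgn : |c.sgn| = 1 := by rcases c.sgn_eq with h | h <;> rw [h] <;> norm_num

lemma deriv_ne (t : ℝ) : deriv c.map t ≠ 0 := fun h => by simpa [h] using c.deriv_pos t

lemma abs_deriv (t : ℝ) : |deriv c.map t| = c.sgn * deriv c.map t := by
  rw [← abs_of_pos (c.deriv_pos t), abs_mul, c.abs_sgn, one_mul]

/-- The weight `1 / |G'|`. -/
noncomputable def weight (x : ℝ) : ℝ := c.sgn / deriv c.map x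

lemma weight_eq_inv_abs (x : ℝ) : c.weight x = |deriv c.map x|⁻¹ := by
  rw [abs_deriv, weight, mul_inv]
  rcases c.sgn_eq with h | h <;> rw [h] <;> norm_num [div_eq_mul_inv]

lemma weight_pos (x : ℝ) : 0 < c.weight x := by
  rw [weight_eq_inv_abs]; exact inv_pos.2 (abs_pos.2 (c.deriv_ne x))

lemma differentiable : Differentiable ℝ c.map := c.contDiff.differentiable (by norm_num)

lemma contDiff_deriv : ContDiff ℝ 1 (deriv c.map) :=
  ((contDiff_succ_iff_deriv (n := 1)).1 c.contDiff).2.2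

lemma continuous_deriv : Continuous (deriv c.map) := c.contDiff_deriv.continuous

lemma continuous_weight : Continuous c.weight :=
  continuous_const.div c.continuous_deriv c.deriv_ne

lemma periodic_deriv : Function.Periodic (deriv c.map) 1 := by
  intro t
  rw [← deriv_comp_add_const, funext c.map_add_one, deriv_add_const]

lemma periodic_weight : Function.Periodic c.weight 1 := fun t => by
  rw [weight, weight, c.periodic_deriv]

lemma hasDerivAt_inv (t : ℝ) : HasDerivAt c.inv (deriv c.map (c.inv t))⁻¹ t :=
  (c.differentiable (c.inv t)).hasDerivAt.of_local_left_inverse c.continuous_inv.continuousAt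
    (c.deriv_ne _) (Eventually.of_forall c.map_inv)

lemma inv_add (t : ℝ) : c.inv (t + c.sgn * c.deg) = c.inv t + 1 := by
  rw [← c.inv_map (c.inv t + 1), c.map_add_one, c.map_inv]

/-- The transfer operator. -/
noncomputable def transfer (u : ℝ → ℝ) (t : ℝ) : ℝ :=
  ∑ k ∈ Finset.range c.deg, u (c.inv (t + k)) * c.weight (c.inv (t + k))

lemma periodic_comp_inv {v : ℝ → ℝ} (hv : Function.Periodic v 1) :
    Function.Periodic (fun t => v (c.inv t)) c.deg := by
  intro t
  have h := fun t => (congrArg v (c.inv_add t)).trans (hv _)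
  rcases c.sgn_eq with hs | hs
  · simpa [hs] using h t
  · simpa [hs] using (h (t + c.deg)).symm

/-- Moving `t` by one trades the term `k = 0` for the term `k = deg`; these agree because
composition with `inv` has period `deg`. -/
lemma transfer_periodic {u : ℝ → ℝ} (hu : Function.Periodic u 1) :
    Function.Periodic (c.transfer u) 1 := by
  intro t
  set φ : ℝ → ℝ := fun t => u (c.inv t) * c.weight (c.inv t) with hφ
  have hper : φ (t + c.deg) = φ t := c.periodic_comp_inv (hu.mul c.periodic_weight) t
  have h1 : c.transfer u (t + 1) = ∑ k ∈ Finset.range c.deg, φ (t + (k + 1 : ℕ)) := by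
    refine Finset.sum_congr rfl fun k _ => ?_
    rw [hφ]; push_cast; ring_nf
  have h2 := Finset.sum_range_succ (fun k : ℕ => φ (t + k)) c.deg
  rw [Finset.sum_range_succ', hper] at h2
  rw [h1]
  simp only [Nat.cast_zero, add_zero, add_left_inj] at h2
  exact h2.symm ▸ rfl

lemma transfer_continuous {u : ℝ → ℝ} (hu : Continuous u) : Continuous (c.transfer u) :=
  continuous_finsetSum _ fun k _ =>
    (hu.comp (c.continuous_inv.comp (by fun_prop))).mul
      (c.continuous_weight.comp (c.continuous_inv.comp (by fun_prop)))

lemma transfer_add (u v : ℝ → ℝ) :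
    c.transfer (fun t => u t + v t) = fun t => c.transfer u t + c.transfer v t := by
  funext t; simp [transfer, add_mul, Finset.sum_add_distrib]

lemma transfer_sub (u v : ℝ → ℝ) :
    c.transfer (fun t => u t - v t) = fun t => c.transfer u t - c.transfer v t := by
  funext t; simp [transfer, sub_mul, Finset.sum_sub_distrib]

lemma transfer_const_mul (a : ℝ) (u : ℝ → ℝ) :
    c.transfer (fun t => a * u t) = fun t => a * c.transfer u t := by
  funext t; simp [transfer, mul_assoc, Finset.mul_sum]

lemma transfer_mono {u v : ℝ → ℝ} (h : ∀ t, u t ≤ v t) (t : ℝ) : c.transfer u t ≤ c.transfer v t :=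
  Finset.sum_le_sum fun _ _ => mul_le_mul_of_nonneg_right (h _) (c.weight_pos _).le

lemma transfer_nonneg {u : ℝ → ℝ} (h : ∀ t, 0 ≤ u t) (t : ℝ) : 0 ≤ c.transfer u t :=
  Finset.sum_nonneg fun _ _ => mul_nonneg (h _) (c.weight_pos _).le

lemma abs_transfer_le (u : ℝ → ℝ) (t : ℝ) : |c.transfer u t| ≤ c.transfer (fun x => |u x|) t := by
  refine (Finset.abs_sum_le_sum_abs _ _).trans_eq (Finset.sum_congr rfl fun k _ => ?_)
  rw [abs_mul, abs_of_pos (c.weight_pos _)]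

/-- Duality with composition: substitute along the cover, then cut the image of the unit interval,
of length `deg`, into unit pieces. -/
lemma integral_comp_mul {g u : ℝ → ℝ} (hg : Continuous g) (hgp : Function.Periodic g 1)
    (hu : Continuous u) (hup : Function.Periodic u 1) :
    ∫ t in (0 : ℝ)..1, g (c.map t) * u t = ∫ t in (0 : ℝ)..1, g t * c.transfer u t := by
  set φ : ℝ → ℝ := fun t => g t * (u (c.inv t) * c.weight (c.inv t)) with hφ
  have hφc : Continuous φ :=
    hg.mul ((hu.comp c.continuous_inv).mul (c.continuous_weight.comp c.continuous_inv))
  -- The base point is arbitrary because for `sgn = -1` the image interval starts at `map 0 - deg`.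
  have key : ∀ b : ℝ, ∫ t in b..(b + c.deg), φ t = ∫ t in (0 : ℝ)..1, g t * c.transfer u t := by
    intro b
    have h1 := intervalIntegral.sum_integral_adjacent_intervals (f := φ) (μ := volume)
      (a := fun k : ℕ => b + k) (n := c.deg) fun k _ => hφc.intervalIntegrable _ _
    simp only [Nat.cast_zero, add_zero] at h1
    rw [← h1]
    have h2 : ∀ k : ℕ, ∫ t in (b + k)..(b + (k + 1 : ℕ)), φ t = ∫ t in b..(b + 1), φ (t + k) := by
      intro k
      rw [intervalIntegral.integral_comp_add_right]
      push_cast; ring_nf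
    simp only [h2]
    rw [← intervalIntegral.integral_finsetSum
      fun k _ => Continuous.intervalIntegrable (by fun_prop) _ _]
    have hper : Function.Periodic (fun t => g t * c.transfer u t) 1 :=
      hgp.mul (c.transfer_periodic hup)
    have h3 := hper.intervalIntegral_add_eq b 0
    rw [zero_add] at h3
    rw [← h3]
    refine intervalIntegral.integral_congr fun t _ => ?_
    simp only [hφ, transfer, Finset.mul_sum]
    refine Finset.sum_congr rfl fun k _ => ?_
    have : g (t + k) = g t := by simpa using hgp.nat_mul k t
    rw [this]
  have h0 : ∫ t in (0 : ℝ)..1, g (c.map t) * u t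
      = c.sgn * ∫ t in (c.map 0)..(c.map 1), φ t := by
    rw [← intervalIntegral.integral_comp_mul_deriv (a := 0) (b := 1)
      (fun x _ => (c.differentiable x).hasDerivAt) c.continuous_deriv.continuousOn hφc,
      ← intervalIntegral.integral_const_mul]
    refine intervalIntegral.integral_congr fun t _ => ?_
    simp only [hφ, Function.comp, c.inv_map, weight]
    have := c.deriv_ne t
    field_simp
    rw [pow_two, c.sgn_mul_self, mul_one]
  have h1 : c.map 1 = c.map 0 + c.sgn * c.deg := by simpa using c.map_add_one 0
  rw [h0, h1]
  rcases c.sgn_eq with hs | hs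
  · rw [hs, one_mul, one_mul, key]
  · rw [hs, intervalIntegral.integral_symm, ← key (c.map 0 + -1 * c.deg)]
    simp

lemma integral_transfer {u : ℝ → ℝ} (hu : Continuous u) (hup : Function.Periodic u 1) :
    ∫ t in (0 : ℝ)..1, c.transfer u t = ∫ t in (0 : ℝ)..1, u t := by
  simpa using (c.integral_comp_mul (g := fun _ => 1) continuous_const (fun _ => rfl) hu hup).symm

lemma l1_transfer_le {u : ℝ → ℝ} (hu : Continuous u) (hup : Function.Periodic u 1) :
    l1 (c.transfer u) ≤ l1 u := by
  have h := l1_mono (c.transfer_continuous hu) (c.transfer_continuous hu.abs) (c.abs_transfer_le u)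
  rwa [c.integral_transfer hu.abs fun t => by simp only [hup t]] at h

/-- The function `(u / G')'`, whose image is the derivative of the image of `u`. -/
noncomputable def derivAux (u : ℝ → ℝ) (x : ℝ) : ℝ :=
  deriv u x / deriv c.map x - u x * deriv (deriv c.map) x / deriv c.map x ^ 2

lemma continuous_derivAux {u : ℝ → ℝ} (hu : C1Per u) : Continuous (c.derivAux u) := by
  refine (hu.continuous_deriv.div c.continuous_deriv c.deriv_ne).sub
    ((hu.continuous.mul (c.contDiff_deriv.continuous_deriv (by norm_num))).div
      (c.continuous_deriv.pow 2) fun x => pow_ne_zero _ (c.deriv_ne x))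

lemma periodic_derivAux {u : ℝ → ℝ} (hu : C1Per u) : Function.Periodic (c.derivAux u) 1 := by
  intro t
  simp only [derivAux, hu.2 t, ClusterSync.periodic_deriv hu.2 t, c.periodic_deriv t,
    ClusterSync.periodic_deriv c.periodic_deriv t]

/-- The sign in the weight and the derivative of the inverse recombine into a weight, so
differentiation stays within the range of the operator. This is what makes the Lasota–Yorke
inequality a one-line estimate. -/
lemma hasDerivAt_transfer {u : ℝ → ℝ} (hu : C1Per u) (t : ℝ) :
    HasDerivAt (c.transfer u) (c.transfer (c.derivAux u) t) t := by
  refine HasDerivAt.fun_sum fun k _ => ?_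
  have h1 : ∀ x, HasDerivAt (fun x => u x * c.weight x) (c.sgn * c.derivAux u x) x := by
    intro x
    have hd := (c.contDiff_deriv.differentiable (by norm_num) x).hasDerivAt
    have := ((hu.differentiable x).hasDerivAt.div hd (c.deriv_ne x)).const_mul c.sgn
    refine (this.congr_deriv ?_).congr_of_eventuallyEq (Eventually.of_forall fun y => ?_)
    · have := c.deriv_ne x
      rw [derivAux]; field_simp
    · simp only [weight, Pi.div_apply]; ring
  have h2 := (c.hasDerivAt_inv (t + k)).comp_add_const t (k : ℝ)
  refine ((h1 (c.inv (t + k))).comp t h2).congr_deriv ?_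
  rw [weight]; ring

lemma deriv_transfer {u : ℝ → ℝ} (hu : C1Per u) :
    deriv (c.transfer u) = c.transfer (c.derivAux u) :=
  funext fun t => (c.hasDerivAt_transfer hu t).deriv

lemma c1Per_transfer {u : ℝ → ℝ} (hu : C1Per u) : C1Per (c.transfer u) := by
  refine ⟨contDiff_one_iff_deriv.2
    ⟨fun t => (c.hasDerivAt_transfer hu t).differentiableAt, ?_⟩, c.transfer_periodic hu.2⟩
  rw [c.deriv_transfer hu]
  exact c.transfer_continuous (c.continuous_derivAux hu)

/-- Bounds for a covering map: `lo ≤ |G'|` and `|G''| ≤ C * G' ^ 2`. -/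
structure Bounds (lo C : ℝ) : Prop where
  pos : 0 < lo
  nonneg : 0 ≤ C
  le_deriv : ∀ t, lo ≤ c.sgn * deriv c.map t
  second : ∀ t, |deriv (deriv c.map) t| ≤ C * deriv c.map t ^ 2

variable {c} in
lemma Bounds.abs_derivAux_le {lo C : ℝ} (hb : c.Bounds lo C) (u : ℝ → ℝ) (x : ℝ) :
    |c.derivAux u x| ≤ lo⁻¹ * |deriv u x| + C * |u x| := by
  refine (abs_sub _ _).trans (add_le_add ?_ ?_)
  · rw [abs_div, c.abs_deriv, div_eq_inv_mul]
    have := hb.pos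
    gcongr
    exact hb.le_deriv x
  · rw [abs_div, abs_mul, abs_of_nonneg (sq_nonneg (deriv c.map x)), div_le_iff₀ (by
      have := c.deriv_ne x
      positivity)]
    calc _ ≤ |u x| * (C * deriv c.map x ^ 2) := by gcongr; exact hb.second x
      _ = _ := by ring

variable {c} in
lemma Bounds.abs_deriv_transfer_le {lo C : ℝ} (hb : c.Bounds lo C) {u : ℝ → ℝ} (hu : C1Per u)
    (t : ℝ) : |deriv (c.transfer u) t| ≤
      lo⁻¹ * c.transfer (fun x => |deriv u x|) t + C * c.transfer (fun x => |u x|) t := by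
  rw [c.deriv_transfer hu]
  refine (c.abs_transfer_le _ t).trans ((c.transfer_mono (hb.abs_derivAux_le u) t).trans_eq ?_)
  rw [c.transfer_add, c.transfer_const_mul, c.transfer_const_mul]

/-- The Lasota–Yorke inequality. -/
lemma Bounds.l1_deriv_transfer_le {c : CircleCover} {lo C : ℝ} (hb : c.Bounds lo C)
    {u : ℝ → ℝ} (hu : C1Per u) :
    l1 (deriv (c.transfer u)) ≤ lo⁻¹ * l1 (deriv u) + C * l1 u := by
  rw [c.deriv_transfer hu]
  refine (c.l1_transfer_le (c.continuous_derivAux hu) (c.periodic_derivAux hu)).trans ?_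
  have h1 := hu.continuous_deriv.abs
  have h2 := hu.continuous.abs
  refine (l1_mono (v := fun x => lo⁻¹ * |deriv u x| + C * |u x|) (c.continuous_derivAux hu)
    ((h1.const_mul lo⁻¹).add (h2.const_mul C))
    (hb.abs_derivAux_le u)).trans_eq ?_
  rw [intervalIntegral.integral_add ((h1.const_mul _).intervalIntegrable _ _)
    ((h2.const_mul _).intervalIntegrable _ _), intervalIntegral.integral_const_mul,
    intervalIntegral.integral_const_mul]
  rfl

end CircleCover

/-! ### `L¹` effect of a near-identity cover. -/

lemma abs_sub_le_integral_window {u : ℝ → ℝ} (hu : C1Per u) {x t e : ℝ} (h : |x - t| ≤ e) :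
    |u x - u t| ≤ ∫ s in (-e)..e, |deriv u (t + s)| := by
  have hc := hu.continuous_deriv
  have h1 : ∫ s in t..x, deriv u s = u x - u t :=
    intervalIntegral.integral_eq_sub_of_hasDerivAt
      (fun y _ => (hu.differentiable y).hasDerivAt) (hc.intervalIntegrable _ _)
  have he : 0 ≤ e := (abs_nonneg _).trans h
  have hw : ∫ s in (-e)..e, |deriv u (t + s)| = ∫ s in (t - e)..(t + e), |deriv u s| := by
    rw [intervalIntegral.integral_comp_add_left (fun s => |deriv u s|)]
    ring_nf
  rw [hw, ← h1, ← Real.norm_eq_abs]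
  refine intervalIntegral.norm_integral_le_abs_integral_norm.trans ?_
  obtain ⟨h2, h3⟩ := abs_le.1 h
  refine (intervalIntegral.abs_integral_mono_interval (c := t - e) (d := t + e) ?_
    (Eventually.of_forall fun _ => norm_nonneg _) (hc.norm.intervalIntegrable _ _)).trans_eq ?_
  · rw [uIoc_of_le (a := t - e) (by linarith)]
    refine Ioc_subset_Ioc ?_ ?_
    · exact le_min (by linarith) (by linarith)
    · exact max_le (by linarith) (by linarith)
  · exact abs_of_nonneg (intervalIntegral.integral_nonneg (by linarith) fun _ _ => norm_nonneg _)

lemma continuous_window {v : ℝ → ℝ} (hv : Continuous v) (e : ℝ) :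
    Continuous fun t => ∫ s in (-e)..e, |v (t + s)| :=
  intervalIntegral.continuous_parametric_intervalIntegral_of_continuous' (by fun_prop) _ _

/-- Fubini and translation invariance. With `abs_sub_le_integral_window`, displacing points by at
most `e` costs at most `2 * e` times the variation in `L¹`. -/
lemma integral_window {v : ℝ → ℝ} (hv : Continuous v) (hp : Function.Periodic v 1) (e : ℝ) :
    ∫ t in (0 : ℝ)..1, ∫ s in (-e)..e, |v (t + s)| = 2 * e * l1 v := by
  rw [intervalIntegral_intervalIntegral_swap]
  · have : ∀ s, ∫ t in (0 : ℝ)..1, |v (t + s)| = l1 v := by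
      intro s
      have hp' : Function.Periodic (fun t => |v t|) 1 := fun t => by simp only [hp t]
      have h := hp'.intervalIntegral_add_eq s 0
      rw [intervalIntegral.integral_comp_add_right (fun t => |v t|)]
      simpa [add_comm, l1] using h
    simp only [this, intervalIntegral.integral_const, smul_eq_mul]
    ring
  · have hc : Continuous (Function.uncurry fun t s => |v (t + s)|) := by fun_prop
    exact (hc.continuousOn.integrableOn_compact (isCompact_uIcc.prod isCompact_uIcc)).mono_set
      (prod_mono uIoc_subset_uIcc uIoc_subset_uIcc)

namespace CircleCover

variable (c : CircleCover)

lemma transfer_of_deg_one (hn : c.deg = 1) (u : ℝ → ℝ) (t : ℝ) :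
    c.transfer u t = u (c.inv t) * c.weight (c.inv t) := by
  simp [transfer, hn]

/-- A cover `C¹`-close to the identity moves densities little in `L¹`. -/
lemma l1_transfer_sub_le (hs : c.sgn = 1) (hn : c.deg = 1) {e : ℝ} (he : e ≤ 1 / 2)
    (h0 : ∀ t, |c.map t - t| ≤ e) (h1 : ∀ t, |deriv c.map t - 1| ≤ e) {u : ℝ → ℝ} (hu : C1Per u) :
    l1 (fun t => c.transfer u t - u t) ≤ e * (4 * l1 (deriv u) + 2 * l1 u) := by
  have he0 : 0 ≤ e := (abs_nonneg _).trans (h0 0)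
  have hw1 : ∀ x, c.weight x ≤ 2 := by
    intro x
    rw [weight, hs, div_le_iff₀] <;> linarith [(abs_le.1 (h1 x)).1]
  have hw2 : ∀ x, |c.weight x - 1| ≤ 2 * e := by
    intro x
    have h2 : c.weight x - 1 = -(c.weight x * (deriv c.map x - 1)) := by
      have := c.deriv_ne x
      rw [weight, hs]; field_simp; ring
    rw [h2, abs_neg, abs_mul, abs_of_pos (c.weight_pos x)]
    exact mul_le_mul (hw1 x) (h1 x) (abs_nonneg _) (by norm_num)
  have hwin := continuous_window hu.continuous_deriv e
  have key : ∀ t, |c.transfer u t - u t| ≤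
      2 * (∫ s in (-e)..e, |deriv u (t + s)|) + 2 * e * |u t| := by
    intro t
    -- The displacement of the point and the defect of the weight from 1 are estimated separately.
    have h3 : c.transfer u t - u t = c.weight (c.inv t) * (u (c.inv t) - u t)
        + (c.weight (c.inv t) - 1) * u t := by
      rw [c.transfer_of_deg_one hn]; ring
    rw [h3]
    refine (abs_add_le _ _).trans (add_le_add ?_ ?_)
    · rw [abs_mul, abs_of_pos (c.weight_pos _)]
      refine mul_le_mul (hw1 _) (abs_sub_le_integral_window hu ?_) (abs_nonneg _) (by norm_num)
      have := h0 (c.inv t)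
      rwa [c.map_inv, abs_sub_comm] at this
    · rw [abs_mul]
      exact mul_le_mul_of_nonneg_right (hw2 _) (abs_nonneg _)
  refine (l1_mono ((c.transfer_continuous hu.continuous).sub hu.continuous)
    (v := fun t => 2 * (∫ s in (-e)..e, |deriv u (t + s)|) + 2 * e * |u t|)
    ((hwin.const_mul 2).add (hu.continuous.abs.const_mul _)) key).trans_eq ?_
  rw [intervalIntegral.integral_add ((hwin.const_mul 2).intervalIntegrable _ _)
    ((hu.continuous.abs.const_mul _).intervalIntegrable _ _), intervalIntegral.integral_const_mul,
    intervalIntegral.integral_const_mul,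
    integral_window hu.continuous_deriv (ClusterSync.periodic_deriv hu.2)]
  simp only [l1]
  ring

/-! ### Covers from lifts, and expansion of intervals. -/

lemma exists_of_lift {G : ℝ → ℝ} {s lo : ℝ} {n : ℕ} (hG : ContDiff ℝ 2 G) (hs : s = 1 ∨ s = -1)
    (hlo : 0 < lo) (hd : ∀ t, lo ≤ s * deriv G t) (h1 : ∀ t, G (t + 1) = G t + s * n) :
    ∃ c : CircleCover, c.map = G ∧ c.sgn = s ∧ c.deg = n := by
  have hss : s * s = 1 := by rcases hs with h | h <;> rw [h] <;> norm_num
  have hGd : Differentiable ℝ G := hG.differentiable (by norm_num)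
  have hd' : ∀ t, lo ≤ deriv (fun t => s * G t) t := fun t => by
    rw [deriv_const_mul _ (hGd t)]; exact hd t
  have hmv := mul_sub_le_image_sub_of_le_deriv (hGd.const_mul s) hd'
  have hmono : StrictMono fun t => s * G t := by
    intro x y hxy
    have := hmv hxy.le
    have h2 : 0 < lo * (y - x) := mul_pos hlo (sub_pos.2 hxy)
    simp only at this ⊢
    linarith
  have hcont : Continuous fun t => s * G t := continuous_const.mul hGd.continuous
  have hsurj : Function.Surjective fun t => s * G t := by
    refine hcont.surjective ?_ ?_
    · refine tendsto_atTop_mono' (f₁ := fun t => lo * t + s * G 0) _ ?_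
        (tendsto_atTop_add_const_right _ _ (tendsto_id.const_mul_atTop hlo))
      filter_upwards [eventually_ge_atTop 0] with t ht
      have : lo * (t - 0) ≤ s * G t - s * G 0 := hmv ht
      linarith
    · refine tendsto_atBot_mono' (f₁ := fun t => lo * t + s * G 0) _ ?_
        (tendsto_atBot_add_const_right _ _ (tendsto_id.const_mul_atBot hlo))
      filter_upwards [eventually_le_atBot 0] with t ht
      have : lo * (0 - t) ≤ s * G 0 - s * G t := hmv ht
      linarith
  let e := hmono.orderIsoOfSurjective _ hsurj
  have he : ∀ t, e t = s * G t := fun t => rfl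
  refine ⟨{ map := G, inv := fun t => e.symm (s * t), sgn := s, deg := n, sgn_eq := hs,
            contDiff := hG, map_inv := fun t => ?_, inv_map := fun t => ?_,
            continuous_inv := e.symm.continuous.comp (continuous_const.mul continuous_id),
            map_add_one := h1, deriv_pos := fun t => hlo.trans_le (hd t) }, rfl, rfl, rfl⟩
  · have h2 := he (e.symm (s * t))
    rw [e.apply_symm_apply] at h2
    have h3 := congrArg (s * ·) h2
    simp only [← mul_assoc, hss, one_mul] at h3
    exact h3.symm
  · rw [← he, e.symm_apply_apply]

variable {c} in
lemma Bounds.mul_sub_le {lo C : ℝ} (hb : c.Bounds lo C) {x y : ℝ} (h : x ≤ y) :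
    lo * (y - x) ≤ c.sgn * c.map y - c.sgn * c.map x := by
  refine mul_sub_le_image_sub_of_le_deriv (f := fun t => c.sgn * c.map t)
    (c.differentiable.const_mul _) (fun t => ?_) h
  rw [deriv_const_mul _ (c.differentiable t)]
  exact hb.le_deriv t

/-- A lower bound on an interval propagates to a longer interval. -/
lemma Bounds.transfer_ge_on {c : CircleCover} {lo C D : ℝ} (hb : c.Bounds lo C)
    (hn : 0 < c.deg) (hD : ∀ t, |deriv c.map t| ≤ D) {u : ℝ → ℝ} (hu : ∀ t, 0 ≤ u t)
    {a l b : ℝ} (h : ∀ t ∈ Icc a (a + l), b ≤ u t) :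
    ∃ a', ∀ t ∈ Icc a' (a' + lo * l), b / D ≤ c.transfer u t := by
  have hDpos : 0 < D := (abs_pos.2 (c.deriv_ne 0)).trans_le (hD 0)
  -- Multiplying by the orientation treats both orientations at once; only the left end of the image
  -- interval differs.
  have key : ∀ t, c.sgn * c.map a ≤ c.sgn * t → c.sgn * t ≤ c.sgn * c.map a + lo * l →
      b / D ≤ c.transfer u t := by
    intro t h1 h2
    have hx : c.inv t ∈ Icc a (a + l) := by
      constructor
      · by_contra! hlt
        have h3 := hb.mul_sub_le hlt.le
        have h4 : 0 < lo * (a - c.inv t) := mul_pos hb.pos (sub_pos.2 hlt)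
        rw [c.map_inv] at h3
        linarith
      · by_contra! hlt
        have h4 := mul_lt_mul_of_pos_left hlt hb.pos
        rcases le_total a (c.inv t) with hle | hle
        · have h3 := hb.mul_sub_le hle
          rw [c.map_inv] at h3
          linarith
        -- The sign of `l` is not known. Here the preimage must equal `a`, so `l < 0`, which
        -- contradicts `h1` and `h2`.
        · have h3 := hb.mul_sub_le hle
          have h5 : 0 ≤ lo * (a - c.inv t) := mul_nonneg hb.pos.le (sub_nonneg.2 hle)
          rw [c.map_inv] at h3
          have h6 : lo * (a - c.inv t) = 0 := by linarith
          have h7 := (mul_eq_zero.1 h6).resolve_left hb.pos.ne'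
          have h8 : l < 0 := by linarith
          have := mul_neg_of_pos_of_neg hb.pos h8
          linarith
    have hterm : b / D ≤ u (c.inv t) * c.weight (c.inv t) := by
      rw [weight_eq_inv_abs, ← div_eq_mul_inv]
      exact div_le_div₀ (hu _) (h _ hx) (abs_pos.2 (c.deriv_ne _)) (hD _)
    refine hterm.trans ?_
    have h0 := Finset.single_le_sum
      (f := fun k : ℕ => u (c.inv (t + k)) * c.weight (c.inv (t + k)))
      (fun k _ => mul_nonneg (hu _) (c.weight_pos _).le) (Finset.mem_range.2 hn)
    simpa [transfer] using h0
  rcases c.sgn_eq with hs | hs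
  · refine ⟨c.map a, fun t ht => key t ?_ ?_⟩ <;> rw [hs] <;> linarith [ht.1, ht.2]
  · refine ⟨c.map a - lo * l, fun t ht => key t ?_ ?_⟩ <;> rw [hs] <;> linarith [ht.1, ht.2]

end CircleCover

/-- Continuous lifts of circle maps have a degree. -/
lemma exists_degree {f : Circ → Circ} {F : ℝ → ℝ} (hF : Continuous F)
    (h : ∀ t : ℝ, f (t : Circ) = ((F t : ℝ) : Circ)) : ∃ d : ℤ, ∀ t, F (t + 1) = F t + d := by
  have h1 : ∀ t, ∃ m : ℤ, (m : ℝ) = F (t + 1) - F t := by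
    intro t
    have h2 : ((F (t + 1) : ℝ) : Circ) = ((F t : ℝ) : Circ) := by
      rw [← h, ← h, AddCircle.coe_add_period]
    have h3 : ((F (t + 1) - F t : ℝ) : Circ) = 0 := by
      rw [AddCircle.coe_sub, h2, sub_self]
    obtain ⟨m, hm⟩ := (AddCircle.coe_eq_zero_iff (1 : ℝ)).1 h3
    exact ⟨m, by simpa using hm⟩
  -- An integer-valued continuous function on the line is constant.
  choose m hm using h1
  have hc : Continuous m := by
    rw [Int.isClosedEmbedding_coe_real.isEmbedding.continuous_iff]
    have : (Int.cast ∘ m : ℝ → ℝ) = fun t => F (t + 1) - F t := funext hm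
    rw [this]
    fun_prop
  refine ⟨m 0, fun t => ?_⟩
  rw [PreconnectedSpace.constant inferInstance hc (x := 0) (y := t), hm]
  ring

/-- An expanding circle map of class `C²` is a cover with bounded distortion. -/
lemma exists_cover {f : Circ → Circ} {F : ℝ → ℝ} (hF : IsC2Lift f F) {σ : ℝ} (hσ : 0 < σ)
    (hexp : ∀ t : ℝ, σ ≤ |deriv F t|) :
    ∃ (c : CircleCover) (C D : ℝ), c.map = F ∧ c.Bounds σ C ∧ 0 < c.deg ∧
      ∀ t, |deriv c.map t| ≤ D := by
  have hFd : ContDiff ℝ 1 (deriv F) := ((contDiff_succ_iff_deriv (n := 1)).1 hF.1).2.2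
  -- The derivative never vanishes, so by the intermediate value theorem its sign is constant.
  obtain ⟨s, hs, hsd⟩ : ∃ s : ℝ, (s = 1 ∨ s = -1) ∧ ∀ t, σ ≤ s * deriv F t := by
    rcases le_or_gt 0 (deriv F 0) with h0 | h0
    · refine ⟨1, Or.inl rfl, fun t => ?_⟩
      rcases le_or_gt 0 (deriv F t) with h | h
      · simpa [abs_of_nonneg h] using hexp t
      · obtain ⟨x, hx⟩ := mem_range_of_exists_le_of_exists_ge hFd.continuous ⟨t, h.le⟩ ⟨0, h0⟩
        have := hexp x
        rw [hx, abs_zero] at this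
        linarith
    · refine ⟨-1, Or.inr rfl, fun t => ?_⟩
      rcases le_or_gt 0 (deriv F t) with h | h
      · obtain ⟨x, hx⟩ := mem_range_of_exists_le_of_exists_ge hFd.continuous ⟨0, h0.le⟩ ⟨t, h⟩
        have := hexp x
        rw [hx, abs_zero] at this
        linarith
      · simpa [abs_of_neg h] using hexp t
  obtain ⟨d, hd⟩ := exists_degree hF.1.continuous hF.2
  have hdpos : 0 < s * d := by
    have h1 := mul_sub_le_image_sub_of_le_deriv (f := fun t => s * F t)
      ((hF.1.differentiable (by norm_num)).const_mul s)
      (fun t => by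
        rw [deriv_const_mul _ (hF.1.differentiable (by norm_num) t)]; exact hsd t) zero_le_one
    have h2 := hd 0
    rw [zero_add] at h2
    simp only [h2] at h1
    linarith
  have hdn : (d : ℝ) = s * d.natAbs := by
    rw [Nat.cast_natAbs, Int.cast_abs]
    rcases hs with hs | hs
    · rw [hs, one_mul] at hdpos ⊢
      rw [abs_of_pos hdpos]
    · rw [hs] at hdpos ⊢
      rw [abs_of_neg (by linarith)]; ring
  obtain ⟨c, hcm, hcs, hcn⟩ := CircleCover.exists_of_lift hF.1 hs hσ hsd
    (n := d.natAbs) fun t => by rw [hd, ← hdn]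
  obtain ⟨D, -, hD⟩ := exists_bound_of_periodic c.continuous_deriv c.periodic_deriv
  obtain ⟨C, hC, hC'⟩ := exists_bound_of_periodic
    (c.contDiff_deriv.continuous_deriv (by norm_num)) (periodic_deriv c.periodic_deriv)
  -- Dividing the bound on `F''` by `σ ^ 2 ≤ F' ^ 2` gives the distortion constant.
  refine ⟨c, C / σ ^ 2, D, hcm, ⟨hσ, by positivity, fun t => ?_, fun t => ?_⟩, ?_, hD⟩
  · rw [hcs, hcm]; exact hsd t
  · refine (hC' t).trans ?_
    have h1 : σ ^ 2 ≤ deriv c.map t ^ 2 := by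
      rw [← sq_abs (deriv c.map t), hcm]
      exact pow_le_pow_left₀ hσ.le (hexp t) 2
    calc C = C / σ ^ 2 * σ ^ 2 := by field_simp
      _ ≤ _ := by gcongr
  · rw [hcn, Int.natAbs_pos]
    rintro rfl
    simp at hdpos

/-! ### Densities of bounded variation. -/

/-- Periodic `C¹` probability densities with variation at most `K`. -/
structure Dens (K : ℝ) (u : ℝ → ℝ) : Prop where
  c1 : C1Per u
  nonneg : ∀ t, 0 ≤ u t
  integral : ∫ t in (0 : ℝ)..1, u t = 1
  var_le : l1 (deriv u) ≤ K

namespace Dens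

variable {K : ℝ} {u : ℝ → ℝ}

lemma mono {K' : ℝ} (h : Dens K u) (hK : K ≤ K') : Dens K' u := ⟨h.1, h.2, h.3, h.4.trans hK⟩

lemma l1_eq (h : Dens K u) : l1 u = 1 := by
  simp only [l1, abs_of_nonneg (h.nonneg _), h.integral]

lemma one : Dens 0 fun _ => 1 := ⟨C1Per.const 1, fun _ => zero_le_one, by simp, by simp [l1]⟩

lemma nonneg_var (h : Dens K u) : 0 ≤ K := (l1_nonneg _).trans h.var_le

/-- A density of bounded variation is bounded below on an interval of controlled length. -/
lemma exists_half_le (h : Dens K u) {M : ℕ} (hM : 2 * K < M) :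
    ∃ a, ∀ t ∈ Icc a (a + (M : ℝ)⁻¹), 1 / 2 ≤ u t := by
  -- Otherwise each of the `M` subintervals has a point where `u < 1 / 2`, so there `u` is at most
  -- `1 / 2` plus its local variation. Integrating and summing gives `1 ≤ 1 / 2 + K / M`, against `2
  -- * K < M`.
  by_contra! hcon
  have hM0 : (0 : ℝ) < M := by linarith [h.nonneg_var]
  have hu := h.c1.continuous
  have hu' := h.c1.continuous_deriv
  have hpart : ∀ g : ℝ → ℝ, Continuous g → ∑ j ∈ Finset.range M,
      ∫ t in ((j : ℝ) * (M : ℝ)⁻¹)..(((j + 1 : ℕ) : ℝ) * (M : ℝ)⁻¹), g t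
        = ∫ t in (0 : ℝ)..1, g t := by
    intro g hg
    rw [intervalIntegral.sum_integral_adjacent_intervals (f := g) (μ := volume)
      (a := fun j : ℕ => (j : ℝ) * (M : ℝ)⁻¹) fun k _ => hg.intervalIntegrable _ _]
    simp [hM0.ne']
  have hj : ∀ j : ℕ, ∫ t in ((j : ℝ) * (M : ℝ)⁻¹)..(((j + 1 : ℕ) : ℝ) * (M : ℝ)⁻¹), u t ≤
      (1 / 2 + ∫ t in ((j : ℝ) * (M : ℝ)⁻¹)..(((j + 1 : ℕ) : ℝ) * (M : ℝ)⁻¹), |deriv u t|)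
        * (M : ℝ)⁻¹ := by
    intro j
    have hend : ((j + 1 : ℕ) : ℝ) * (M : ℝ)⁻¹ = (j : ℝ) * (M : ℝ)⁻¹ + (M : ℝ)⁻¹ := by
      push_cast; ring
    rw [hend]
    set a := (j : ℝ) * (M : ℝ)⁻¹
    have hle : a ≤ a + (M : ℝ)⁻¹ := by simp
    obtain ⟨x, hx, hxu⟩ := hcon a
    have hb : ∀ t ∈ Icc a (a + (M : ℝ)⁻¹),
        u t ≤ 1 / 2 + ∫ s in a..(a + (M : ℝ)⁻¹), |deriv u s| := by
      intro t ht
      have h1 : ∫ s in x..t, deriv u s = u t - u x :=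
        intervalIntegral.integral_eq_sub_of_hasDerivAt
          (fun y _ => (h.c1.differentiable y).hasDerivAt) (hu'.intervalIntegrable _ _)
      have h2 : |u t - u x| ≤ ∫ s in a..(a + (M : ℝ)⁻¹), |deriv u s| := by
        rw [← h1, ← Real.norm_eq_abs]
        refine intervalIntegral.norm_integral_le_abs_integral_norm.trans ?_
        refine (intervalIntegral.abs_integral_mono_interval (c := a) (d := a + (M : ℝ)⁻¹) ?_
          (Eventually.of_forall fun _ => norm_nonneg _) (hu'.norm.intervalIntegrable _ _)).trans_eq
          (abs_of_nonneg (intervalIntegral.integral_nonneg hle fun _ _ => norm_nonneg _))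
        rw [uIoc_of_le hle]
        exact Ioc_subset_Ioc (le_min hx.1 ht.1) (max_le hx.2 ht.2)
      linarith [le_abs_self (u t - u x)]
    refine (intervalIntegral.integral_mono_on hle (hu.intervalIntegrable _ _)
      (intervalIntegrable_const (μ := volume)) hb).trans_eq ?_
    rw [intervalIntegral.integral_const, smul_eq_mul]
    ring
  have hsum := Finset.sum_le_sum fun j (_ : j ∈ Finset.range M) => hj j
  rw [hpart u hu, h.integral, ← Finset.sum_mul, Finset.sum_add_distrib,
    hpart (fun t => |deriv u t|) hu'.abs] at hsum
  have h3 := h.var_le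
  rw [l1] at h3
  simp only [Finset.sum_const, Finset.card_range, nsmul_eq_mul] at hsum
  rw [← div_eq_mul_inv, le_div_iff₀ hM0] at hsum
  linarith

/-- Removing a constant from a density and normalizing. -/
lemma sub_const (h : Dens K u) {b : ℝ} (hb : b ≤ 1 / 2) (hbu : ∀ t, b ≤ u t) :
    Dens (2 * K) fun t => (1 - b)⁻¹ * (u t - b) := by
  have hb1 : 0 < 1 - b := by linarith
  refine ⟨(h.c1.sub (C1Per.const b)).const_mul _,
    fun t => mul_nonneg (inv_pos.2 hb1).le (sub_nonneg.2 (hbu t)), ?_, ?_⟩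
  · rw [intervalIntegral.integral_const_mul, intervalIntegral.integral_sub
      (h.c1.continuous.intervalIntegrable _ _) (intervalIntegrable_const (μ := volume)), h.integral]
    simp [hb1.ne']
  · have h1 : deriv (fun t => (1 - b)⁻¹ * (u t - b)) = fun t => (1 - b)⁻¹ * deriv u t := by
      funext t
      rw [deriv_const_mul _ ((h.c1.differentiable t).sub_const b), deriv_sub_const]
    rw [h1, l1_const_mul, abs_of_pos (inv_pos.2 hb1)]
    have h2 : (1 - b)⁻¹ ≤ 2 := by
      rw [inv_le_comm₀ hb1 two_pos]; linarith
    exact mul_le_mul h2 h.var_le (l1_nonneg _) (by norm_num)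

end Dens

/-- A periodic function is bounded by its `W^{1,1}` norm. -/
lemma abs_le_l1_deriv_add_l1 {u : ℝ → ℝ} (hu : C1Per u) (t : ℝ) :
    |u t| ≤ l1 (deriv u) + l1 u := by
  obtain ⟨y, hy, hy'⟩ := hu.2.exists_mem_Ico₀ one_pos t
  rw [hy']
  have hu' := hu.continuous_deriv
  have key : ∀ x ∈ Icc (0 : ℝ) 1, |u y| ≤ l1 (deriv u) + |u x| := by
    intro x hx
    have h1 : ∫ s in x..y, deriv u s = u y - u x :=
      intervalIntegral.integral_eq_sub_of_hasDerivAt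
        (fun y _ => (hu.differentiable y).hasDerivAt) (hu'.intervalIntegrable _ _)
    have h2 : |u y - u x| ≤ l1 (deriv u) := by
      rw [← h1, ← Real.norm_eq_abs]
      refine intervalIntegral.norm_integral_le_abs_integral_norm.trans ?_
      refine (intervalIntegral.abs_integral_mono_interval (c := 0) (d := 1) ?_
        (Eventually.of_forall fun _ => norm_nonneg _) (hu'.norm.intervalIntegrable _ _)).trans_eq
        (abs_of_nonneg (intervalIntegral.integral_nonneg zero_le_one fun _ _ => norm_nonneg _))
      rw [uIoc_of_le zero_le_one]
      exact Ioc_subset_Ioc (le_min hx.1 hy.1) (max_le hx.2 hy.2.le)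
    have := abs_sub_abs_le_abs_sub (u y) (u x)
    linarith
  -- Averaging over `x` replaces the unknown value `|u x|` by the `L¹` norm.
  have h3 := intervalIntegral.integral_mono_on (g := fun x => l1 (deriv u) + |u x|) zero_le_one
    (intervalIntegrable_const (μ := volume)) ((continuous_const.add hu.continuous.abs).intervalIntegrable _ _) key
  rw [intervalIntegral.integral_const] at h3
  simp only [sub_zero, one_smul] at h3
  refine h3.trans_eq ?_
  rw [intervalIntegral.integral_add (intervalIntegrable_const (μ := volume))
    (hu.continuous.abs.intervalIntegrable _ _)]
  simp [l1]

/-! ### Iterated Lasota–Yorke bounds and loss of memory. -/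

namespace CircleCover

variable (c : CircleCover)

lemma c1Per_iterate {u : ℝ → ℝ} (hu : C1Per u) (n : ℕ) : C1Per (c.transfer^[n] u) := by
  induction n with
  | zero => exact hu
  | succ n ih => rw [Function.iterate_succ_apply']; exact c.c1Per_transfer ih

lemma iterate_sub (u v : ℝ → ℝ) (n : ℕ) : c.transfer^[n] (fun t => u t - v t) =
    fun t => c.transfer^[n] u t - c.transfer^[n] v t := by
  induction n with
  | zero => rfl
  | succ n ih => simp only [Function.iterate_succ_apply', ih, c.transfer_sub]

lemma iterate_const_mul (a : ℝ) (u : ℝ → ℝ) (n : ℕ) : c.transfer^[n] (fun t => a * u t) =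
    fun t => a * c.transfer^[n] u t := by
  induction n with
  | zero => rfl
  | succ n ih => simp only [Function.iterate_succ_apply', ih, c.transfer_const_mul]

lemma l1_iterate_le {u : ℝ → ℝ} (hu : C1Per u) (n : ℕ) : l1 (c.transfer^[n] u) ≤ l1 u := by
  induction n with
  | zero => exact le_rfl
  | succ n ih =>
    rw [Function.iterate_succ_apply']
    have h := c.c1Per_iterate hu n
    exact (c.l1_transfer_le h.continuous h.2).trans ih

variable {c} {lo C : ℝ}

lemma Bounds.dens_transfer (hb : c.Bounds lo C) {K : ℝ} {u : ℝ → ℝ} (h : Dens K u) :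
    Dens (lo⁻¹ * K + C) (c.transfer u) := by
  refine ⟨c.c1Per_transfer h.c1, c.transfer_nonneg h.nonneg, ?_, ?_⟩
  · rw [c.integral_transfer h.c1.continuous h.c1.2, h.integral]
  · refine (hb.l1_deriv_transfer_le h.c1).trans ?_
    rw [h.l1_eq, mul_one]
    have := hb.pos
    gcongr
    exact h.var_le

/-- `C / (1 - lo⁻¹)` is the fixed point of `K ↦ lo⁻¹ * K + C`, so the memory of the initial
variation fades geometrically. -/
lemma Bounds.dens_iterate (hb : c.Bounds lo C) (hlo : 1 < lo) {K : ℝ} {u : ℝ → ℝ} (h : Dens K u)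
    (n : ℕ) : Dens (lo⁻¹ ^ n * K + C / (1 - lo⁻¹)) (c.transfer^[n] u) := by
  have h1 : 0 < 1 - lo⁻¹ := sub_pos.2 (inv_lt_one_of_one_lt₀ hlo)
  induction n with
  | zero => exact h.mono (by simpa using div_nonneg hb.nonneg h1.le)
  | succ n ih =>
    rw [Function.iterate_succ_apply']
    refine (hb.dens_transfer ih).mono (le_of_eq ?_)
    rw [pow_succ]
    generalize lo⁻¹ = a at h1 ⊢
    field_simp
    ring

/-- Iterates of the transfer operator are uniformly positive on densities of bounded variation. -/
lemma Bounds.exists_le_iterate (hb : c.Bounds lo C) (hlo : 1 < lo) (hn : 0 < c.deg) {D : ℝ}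
    (hD : ∀ t, |deriv c.map t| ≤ D) (K : ℝ) :
    ∃ N₀ : ℕ, ∀ N ≥ N₀, ∃ b > 0, ∀ u, Dens K u → ∀ t, b ≤ c.transfer^[N] u t := by
  have hDpos : 0 < D := (abs_pos.2 (c.deriv_ne 0)).trans_le (hD 0)
  obtain ⟨M, hM⟩ := exists_nat_gt (max (2 * K) 0)
  have hM0 : (0 : ℝ) < M := (le_max_right _ _).trans_lt hM
  obtain ⟨N₀, hN₀⟩ := pow_unbounded_of_one_lt (M : ℝ) hlo
  -- Each step divides the lower bound by at most `D` and multiplies the interval by `lo`; after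
  -- `N₀` steps the length `lo ^ N / M` exceeds one period.
  refine ⟨N₀, fun N hN => ⟨1 / 2 / D ^ N, by positivity, fun u hu t => ?_⟩⟩
  have key : ∀ n : ℕ, ∃ a, ∀ t ∈ Icc a (a + lo ^ n * (M : ℝ)⁻¹),
      1 / 2 / D ^ n ≤ c.transfer^[n] u t := by
    intro n
    induction n with
    | zero => simpa using hu.exists_half_le ((le_max_left _ _).trans_lt hM)
    | succ n ih =>
      obtain ⟨a, ha⟩ := ih
      obtain ⟨a', ha'⟩ := hb.transfer_ge_on hn hD (hb.dens_iterate hlo hu n).nonneg ha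
      refine ⟨a', fun t ht => ?_⟩
      rw [Function.iterate_succ_apply', pow_succ D, ← div_div]
      refine ha' t ?_
      rwa [← mul_assoc, ← pow_succ']
  obtain ⟨a, ha⟩ := key N
  obtain ⟨y, hy, hy'⟩ := (c.c1Per_iterate hu.c1 N).2.exists_mem_Ico one_pos t a
  rw [hy']
  refine ha y ⟨hy.1, hy.2.le.trans (add_le_add le_rfl ?_)⟩
  rw [← div_eq_mul_inv, le_div_iff₀ hM0, one_mul]
  exact hN₀.le.trans (pow_le_pow_right₀ hlo.le hN)

lemma exists_pow_ge {b θ₀ : ℝ} (hb : 0 < b) (hθ₀' : θ₀ < 1) (N : ℕ) :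
    ∃ θ, θ₀ < θ ∧ θ < 1 ∧ 1 - b ≤ θ ^ N := by
  have h : ∀ᶠ θ in 𝓝[<] (1 : ℝ), 1 - b < θ ^ N := by
    have hc : ContinuousAt (fun θ : ℝ => θ ^ N) 1 := by fun_prop
    exact (Tendsto.eventually_const_lt (by simpa using hb) hc).filter_mono nhdsWithin_le_nhds
  obtain ⟨θ, h1, h2⟩ := (h.and (Ioo_mem_nhdsLT hθ₀')).exists
  exact ⟨θ, h2.1, h2.2, h1.le⟩

/-- Exponential loss of memory in `L¹`, uniformly over densities of bounded variation. -/
lemma Bounds.exists_l1_decay (hb : c.Bounds lo C) (hlo : 1 < lo) (hn : 0 < c.deg) {D : ℝ}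
    (hD : ∀ t, |deriv c.map t| ≤ D) (K : ℝ) :
    ∃ θ A, lo⁻¹ < θ ∧ θ < 1 ∧ 0 < A ∧ ∀ m u v, Dens K u → Dens K v →
      l1 (fun t => c.transfer^[m] u t - c.transfer^[m] v t) ≤ A * θ ^ m := by
  have hinv : 0 < lo⁻¹ := inv_pos.2 hb.pos
  have hinv1 : lo⁻¹ < 1 := inv_lt_one_of_one_lt₀ hlo
  set B := C / (1 - lo⁻¹) with hB
  have hB0 : 0 ≤ B := div_nonneg hb.nonneg (sub_pos.2 hinv1).le
  -- After `N` steps the variation is at most `K' / 4 + B ≤ K' / 2`; removing a constant and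
  -- normalizing at most doubles it, so the class `K'` is recovered.
  set K' := max K (4 * B) with hK'
  obtain ⟨N₀, hN₀⟩ := hb.exists_le_iterate hlo hn hD K'
  obtain ⟨N₁, hN₁⟩ := exists_pow_lt_of_lt_one (show (0 : ℝ) < 1 / 4 by norm_num) hinv1
  -- `N ≥ 1` is needed for the strong induction to descend.
  set N := max (max N₀ N₁) 1 with hN
  have hN4 : lo⁻¹ ^ N ≤ 1 / 4 := (pow_le_pow_of_le_one hinv.le hinv1.le
    ((le_max_right N₀ N₁).trans (le_max_left _ _))).trans hN₁.le
  obtain ⟨b₀, hb₀, hlow⟩ := hN₀ N ((le_max_left N₀ N₁).trans (le_max_left _ _))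
  set b := min b₀ (1 / 2) with hbdef
  have hb0 : 0 < b := lt_min hb₀ (by norm_num)
  have hb2 : b ≤ 1 / 2 := min_le_right _ _
  obtain ⟨θ, hθ0, hθ1, hθN⟩ := exists_pow_ge hb0 hinv1 N
  have hθpos : 0 < θ := hinv.trans hθ0
  -- The prefactor makes the trivial bound 2 suffice for `m < N`.
  refine ⟨θ, 2 / θ ^ N, hθ0, hθ1, by positivity, fun m => ?_⟩
  suffices H : ∀ u v, Dens K' u → Dens K' v →
      l1 (fun t => c.transfer^[m] u t - c.transfer^[m] v t) ≤ 2 / θ ^ N * θ ^ m from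
    fun u v hu hv => H u v (hu.mono (le_max_left _ _)) (hv.mono (le_max_left _ _))
  induction m using Nat.strong_induction_on with
  | _ m ih =>
    intro u v hu hv
    rcases lt_or_ge m N with hm | hm
    · have h1 : l1 (fun t => c.transfer^[m] u t - c.transfer^[m] v t) ≤ 2 := by
        rw [← c.iterate_sub]
        refine (c.l1_iterate_le (hu.c1.sub hv.c1) m).trans ?_
        have := l1_sub_le hu.c1.continuous continuous_const hv.c1.continuous (v := fun _ => 0)
        have h2 : l1 (fun t => 0 - v t) = l1 v := by simp [l1]
        simp only [sub_zero] at this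
        rw [h2, hu.l1_eq, hv.l1_eq] at this
        linarith
      refine h1.trans ?_
      rw [div_mul_eq_mul_div, le_div_iff₀ (by positivity)]
      exact mul_le_mul_of_nonneg_left (pow_le_pow_of_le_one hθpos.le hθ1.le hm.le) two_pos.le
    · have step : ∀ w, Dens K' w → Dens K' fun t => (1 - b)⁻¹ * (c.transfer^[N] w t - b) := by
        intro w hw
        refine ((hb.dens_iterate hlo hw N).sub_const hb2
          fun t => (min_le_left _ _).trans (hlow w hw t)).mono ?_
        have h3 : 4 * B ≤ K' := le_max_right _ _
        have h4 : lo⁻¹ ^ N * K' ≤ 1 / 4 * K' := mul_le_mul_of_nonneg_right hN4 hw.nonneg_var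
        linarith
      obtain ⟨k, rfl⟩ := Nat.exists_eq_add_of_le hm
      have h5 := ih k (by omega) _ _ (step u hu) (step v hv)
      -- Doeblin coupling: the common constant `b` cancels, leaving mass `1 - b ≤ θ ^ N` on two
      -- normalized densities of the same class.
      have h6 : (fun t => c.transfer^[N + k] u t - c.transfer^[N + k] v t) = fun t => (1 - b) *
          (c.transfer^[k] (fun t => (1 - b)⁻¹ * (c.transfer^[N] u t - b)) t
            - c.transfer^[k] (fun t => (1 - b)⁻¹ * (c.transfer^[N] v t - b)) t) := by
        have hb1 : 1 - b ≠ 0 := by linarith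
        funext t
        simp only [c.iterate_const_mul, c.iterate_sub, add_comm N k, Function.iterate_add_apply]
        field_simp
        ring
      rw [h6, l1_const_mul, abs_of_pos (by linarith), pow_add]
      calc (1 - b) * _ ≤ θ ^ N * (2 / θ ^ N * θ ^ k) :=
            mul_le_mul hθN h5 (l1_nonneg _) (by positivity)
        _ = _ := by ring

/-- Exponential loss of memory in the uniform norm. -/
lemma Bounds.exists_decay (hb : c.Bounds lo C) (hlo : 1 < lo) (hn : 0 < c.deg) {D : ℝ}
    (hD : ∀ t, |deriv c.map t| ≤ D) (K : ℝ) :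
    ∃ θ A, lo⁻¹ < θ ∧ θ < 1 ∧ 0 < A ∧ ∀ m u v, Dens K u → Dens K v →
      ∀ t, |c.transfer^[m] u t - c.transfer^[m] v t| ≤ A * θ ^ m := by
  obtain ⟨θ, A, hθ0, hθ1, hA, H⟩ := hb.exists_l1_decay hlo hn hD K
  have hinv : 0 < lo⁻¹ := inv_pos.2 hb.pos
  have hθpos : 0 < θ := hinv.trans hθ0
  -- Chosen so that `lo⁻¹ * E + C * A ≤ E * θ`, which closes the recursion for the variation; this
  -- is why `θ > lo⁻¹` is carried along.
  set E := max (2 * K) (C * A / (θ - lo⁻¹)) with hE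
  have hE1 : C * A ≤ E * (θ - lo⁻¹) := by
    rw [← div_le_iff₀ (sub_pos.2 hθ0)]; exact le_max_right _ _
  have hE0 : 0 ≤ E := le_max_of_le_right
    (div_nonneg (mul_nonneg hb.nonneg hA.le) (sub_pos.2 hθ0).le)
  refine ⟨θ, E + A, hθ0, hθ1, by linarith, fun m u v hu hv t => ?_⟩
  have hc : ∀ m, C1Per fun t => c.transfer^[m] u t - c.transfer^[m] v t := fun m =>
    (c.c1Per_iterate hu.c1 m).sub (c.c1Per_iterate hv.c1 m)
  have hvar : ∀ m, l1 (deriv fun t => c.transfer^[m] u t - c.transfer^[m] v t) ≤ E * θ ^ m := by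
    intro m
    induction m with
    | zero =>
      have h1 : (deriv fun t => u t - v t) = fun t => deriv u t - deriv v t := funext fun t =>
        deriv_fun_sub (hu.c1.differentiable t) (hv.c1.differentiable t)
      have := l1_sub_le hu.c1.continuous_deriv continuous_const hv.c1.continuous_deriv
        (v := fun _ => 0)
      have h2 : l1 (fun t => 0 - deriv v t) = l1 (deriv v) := by simp [l1]
      simp only [sub_zero] at this
      rw [h2, ← h1] at this
      simp only [Function.iterate_zero_apply, pow_zero, mul_one]
      have h3 := le_max_left (2 * K) (C * A / (θ - lo⁻¹))
      linarith [hu.var_le, hv.var_le]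
    | succ m ih =>
      have h1 := hb.l1_deriv_transfer_le (hc m)
      rw [c.transfer_sub] at h1
      simp only [Function.iterate_succ_apply']
      refine h1.trans ?_
      have h2 : C * l1 (fun t => c.transfer^[m] u t - c.transfer^[m] v t) ≤ C * (A * θ ^ m) :=
        mul_le_mul_of_nonneg_left (H m u v hu hv) hb.nonneg
      have h3 := mul_le_mul_of_nonneg_left ih hinv.le
      have h4 := mul_le_mul_of_nonneg_right hE1 (pow_pos hθpos m).le
      rw [pow_succ]
      nlinarith
  refine (abs_le_l1_deriv_add_l1 (hc m) t).trans ?_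
  rw [add_mul]
  exact add_le_add (hvar m) (H m u v hu hv)

end CircleCover

/-! ### Construction of a `C¹` invariant density. -/

namespace CircleCover

variable {c : CircleCover} {lo C : ℝ}

/-- An expanding `C²` cover has an invariant probability density of class `C¹`. -/
lemma Bounds.exists_invariant (hb : c.Bounds lo C) (hlo : 1 < lo) (hn : 0 < c.deg) {D : ℝ}
    (hD : ∀ t, |deriv c.map t| ≤ D) : ∃ K r, Dens K r ∧ c.transfer r = r := by
  have hinv : 0 < lo⁻¹ := inv_pos.2 hb.pos
  set B := C / (1 - lo⁻¹) with hB
  have hone : ∀ n, Dens B (c.transfer^[n] fun _ => 1) := fun n => by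
    simpa using hb.dens_iterate hlo Dens.one n
  obtain ⟨N, hN⟩ := hb.exists_le_iterate hlo hn hD B
  obtain ⟨b, hb0, hlow⟩ := hN N le_rfl
  obtain ⟨θ, A, hθ0, hθ1, hA, hdec⟩ := hb.exists_decay hlo hn hD B
  have hθpos : 0 < θ := hinv.trans hθ0
  -- Starting after `N` steps provides the uniform lower bound `b` on every `h n`.
  set h : ℕ → ℝ → ℝ := fun n => c.transfer^[n + N] fun _ => 1 with hh
  have hdens : ∀ n, Dens B (h n) := fun n => hone _
  have hsucc : ∀ n, h (n + 1) = c.transfer (h n) := fun n => by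
    simp only [hh, add_right_comm n 1 N, Function.iterate_succ_apply']
  have hiter : ∀ n m, c.transfer^[n] (h m) = h (n + m) := fun n m => by
    simp only [hh, ← Function.iterate_add_apply, add_assoc]
  have hge : ∀ n t, b ≤ h n t := fun n t => by
    have := hlow _ (hone n) t
    rwa [← Function.iterate_add_apply, add_comm] at this
  have hle : ∀ n t, h n t ≤ B + 1 := fun n t => by
    have h1 := abs_le_l1_deriv_add_l1 (hdens n).c1 t
    rw [(hdens n).l1_eq] at h1
    linarith [le_abs_self (h n t), (hdens n).var_le]
  set w : ℕ → ℝ → ℝ := fun n t => h (n + 1) t - h n t with hw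
  have hwc : ∀ n, C1Per (w n) := fun n => (hdens _).c1.sub (hdens _).c1
  have hwsucc : ∀ n, w (n + 1) = c.transfer (w n) := fun n => by
    simp only [hw]
    rw [c.transfer_sub, ← hsucc, ← hsucc]
  have hwb : ∀ n t, |w n t| ≤ A * θ ^ n := fun n t => by
    have := hdec n _ _ (hdens 1) (hdens 0) t
    rwa [hiter, hiter] at this
  obtain ⟨S, hS, hS'⟩ := exists_bound_of_periodic (hwc 0).continuous_deriv
    (ClusterSync.periodic_deriv (hwc 0).2)
  set E := max (S / b) (C * A / b / (θ - lo⁻¹)) with hE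
  have hE0 : 0 ≤ E := le_max_of_le_left (by positivity)
  have hE1 : C * A / b ≤ E * (θ - lo⁻¹) := by
    rw [← div_le_iff₀ (sub_pos.2 hθ0)]; exact le_max_right _ _
  -- A `C¹` limit needs pointwise control of derivatives, which the `L¹` Lasota–Yorke inequality
  -- does not give. Using `h n` as comparison function makes the bound reproduce itself, since the
  -- operator sends `h n` to `h (n + 1)`.
  have hder : ∀ n t, |deriv (w n) t| ≤ E * θ ^ n * h n t := by
    intro n
    induction n with
    | zero =>
      intro t
      rw [pow_zero, mul_one]
      calc _ ≤ S := hS' t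
        _ = S / b * b := by field_simp
        _ ≤ _ := mul_le_mul (le_max_left _ _) (hge 0 t) hb0.le hE0
    | succ n ih =>
      intro t
      rw [hwsucc]
      refine (hb.abs_deriv_transfer_le (hwc n) t).trans ?_
      have h1 : c.transfer (fun x => |deriv (w n) x|) t ≤ E * θ ^ n * h (n + 1) t := by
        refine (c.transfer_mono ih t).trans_eq ?_
        rw [c.transfer_const_mul, hsucc]
      have h2 : c.transfer (fun x => |w n x|) t ≤ A * θ ^ n / b * h (n + 1) t := by
        refine (c.transfer_mono (v := fun x => A * θ ^ n / b * h n x) (fun x => ?_) t).trans_eq ?_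
        · rw [div_mul_eq_mul_div, le_div_iff₀ hb0]
          exact mul_le_mul (hwb n x) (hge n x) hb0.le (by positivity)
        · rw [c.transfer_const_mul, hsucc]
      have h3 := mul_le_mul_of_nonneg_left h1 hinv.le
      have h4 := mul_le_mul_of_nonneg_left h2 hb.nonneg
      have h5 := mul_le_mul_of_nonneg_right hE1
        (mul_nonneg (pow_pos hθpos n).le (hb0.le.trans (hge (n + 1) t)))
      refine (add_le_add h3 h4).trans ?_
      rw [pow_succ]
      calc _ = lo⁻¹ * (E * θ ^ n * h (n + 1) t) + C * A / b * (θ ^ n * h (n + 1) t) := by ring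
        _ ≤ _ := by linarith
  have hsum : ∀ k : ℝ, Summable fun n => k * θ ^ n := fun k =>
    (summable_geometric_of_lt_one hθpos.le hθ1).mul_left k
  set r : ℝ → ℝ := fun t => h 0 t + ∑' n, w n t with hr
  have hrc : ContDiff ℝ 1 r := by
    refine (hdens 0).c1.1.add (contDiff_tsum (N := 1)
      (v := fun k n => (A + E * (B + 1)) * θ ^ n) (fun n => (hwc n).1) (fun k _ => hsum _) ?_)
    intro k n t hk
    have hEB : 0 ≤ E * (B + 1) := mul_nonneg hE0 (hb0.le.trans ((hge 0 0).trans (hle 0 0)))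
    have hk' : k ≤ 1 := by exact_mod_cast hk
    interval_cases k
    · rw [norm_iteratedFDeriv_zero, Real.norm_eq_abs]
      refine (hwb n t).trans ?_
      gcongr
      linarith
    · rw [norm_iteratedFDeriv_one, ← norm_deriv_eq_norm_fderiv, Real.norm_eq_abs]
      refine (hder n t).trans ?_
      calc E * θ ^ n * h n t ≤ E * θ ^ n * (B + 1) := by gcongr; exact hle n t
        _ = E * (B + 1) * θ ^ n := by ring
        _ ≤ _ := by gcongr; linarith
  have hlim : ∀ t, Tendsto (fun n => h n t) atTop (𝓝 (r t)) := by
    intro t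
    have hs : Summable fun n => w n t := .of_norm_bounded (hsum A) fun n => hwb n t
    have h1 := hs.hasSum.tendsto_sum_nat.const_add (h 0 t)
    refine h1.congr fun n => ?_
    rw [Finset.sum_range_sub (fun n => h n t)]
    ring
  have hper : Function.Periodic r 1 := fun t =>
    tendsto_nhds_unique (hlim (t + 1)) ((hlim t).congr fun n => ((hdens n).c1.2 t).symm)
  refine ⟨l1 (deriv r), r, ⟨⟨hrc, hper⟩, fun t => ?_, ?_, le_rfl⟩, funext fun t => ?_⟩
  · exact ge_of_tendsto' (hlim t) fun n => (hdens n).nonneg t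
  · have h1 : Tendsto (fun n => ∫ t in (0 : ℝ)..1, h n t) atTop (𝓝 (∫ t in (0 : ℝ)..1, r t)) := by
      refine intervalIntegral.tendsto_integral_filter_of_dominated_convergence (fun _ => B + 1)
        (Eventually.of_forall fun n => (hdens n).c1.continuous.aestronglyMeasurable)
        (Eventually.of_forall fun n => Eventually.of_forall fun t _ => ?_)
        (intervalIntegrable_const (μ := volume)) (Eventually.of_forall fun t _ => hlim t)
      rw [Real.norm_eq_abs, abs_of_nonneg ((hdens n).nonneg t)]
      exact hle n t
    simp only [(hdens _).integral] at h1
    exact (tendsto_nhds_unique h1 tendsto_const_nhds)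
  · have h1 : Tendsto (fun n => c.transfer (h n) t) atTop (𝓝 (c.transfer r t)) :=
      tendsto_finsetSum _ fun k _ => (hlim _).mul_const _
    refine tendsto_nhds_unique h1 (((tendsto_add_atTop_iff_nat 1).2 (hlim t)).congr fun n => ?_)
    rw [hsucc]

end CircleCover

/-! ### Passage between periodic densities and measures on the circle. -/

lemma continuous_circ_iff {X : Type*} [TopologicalSpace X] {g : Circ → X} :
    Continuous g ↔ Continuous fun t : ℝ => g (t : Circ) :=
  (QuotientAddGroup.isQuotientMap_mk (AddSubgroup.zmultiples (1 : ℝ))).continuous_iff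

lemma continuous_coe_circ : Continuous fun t : ℝ => (t : Circ) := continuous_circ_iff.1 continuous_id

lemma periodic_coe_circ {X : Type*} (g : Circ → X) : Function.Periodic (fun t : ℝ => g (t : Circ)) 1 :=
  fun t => by simp only [AddCircle.coe_add_period]

lemma integral_circ (g : Circ → ℝ) : ∫ x, g x = ∫ t in (0 : ℝ)..1, g (t : Circ) := by
  rw [← UnitAddCircle.intervalIntegral_preimage 0 g, zero_add]

/-- The function on the circle induced by a periodic function on the line. -/
noncomputable def descend (u : ℝ → ℝ) (x : Circ) : ℝ := u (Quotient.out x)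

lemma descend_coe {u : ℝ → ℝ} (hu : Function.Periodic u 1) (t : ℝ) : descend u (t : Circ) = u t := by
  have h : ((Quotient.out (t : Circ) : ℝ) : Circ) = (t : Circ) := Quotient.out_eq _
  rw [descend, ← hu.lift_coe, ← hu.lift_coe t]
  exact congrArg hu.lift h

lemma continuous_descend {u : ℝ → ℝ} (hc : Continuous u) (hu : Function.Periodic u 1) :
    Continuous (descend u) := by
  rw [continuous_circ_iff]
  simpa only [descend_coe hu] using hc

/-- The measure on the circle with density `u`. -/
noncomputable def meas (u : ℝ → ℝ) : Measure Circ :=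
  volume.withDensity fun x => ENNReal.ofReal (descend u x)

lemma Dens.descend_nonneg {K : ℝ} {u : ℝ → ℝ} (h : Dens K u) (x : Circ) : 0 ≤ descend u x :=
  h.nonneg _

lemma Dens.continuous_descend {K : ℝ} {u : ℝ → ℝ} (h : Dens K u) : Continuous (descend u) :=
  ClusterSync.continuous_descend h.c1.continuous h.c1.2

lemma integrable_of_continuous {g : Circ → ℝ} (hg : Continuous g) (μ : Measure Circ)
    [IsFiniteMeasure μ] : Integrable g μ :=
  (BoundedContinuousFunction.mkOfCompact ⟨g, hg⟩).integrable μ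

lemma Dens.integral_meas {K : ℝ} {u : ℝ → ℝ} (h : Dens K u) (g : Circ → ℝ) :
    ∫ x, g x ∂(meas u) = ∫ t in (0 : ℝ)..1, g (t : Circ) * u t := by
  rw [meas, integral_withDensity_eq_integral_toReal_smul
    (h.continuous_descend.measurable.ennreal_ofReal) (Eventually.of_forall fun _ =>
      ENNReal.ofReal_lt_top), integral_circ]
  refine intervalIntegral.integral_congr fun t _ => ?_
  rw [ENNReal.toReal_ofReal (h.descend_nonneg _), smul_eq_mul, descend_coe h.c1.2, mul_comm]

lemma Dens.isProbabilityMeasure {K : ℝ} {u : ℝ → ℝ} (h : Dens K u) :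
    IsProbabilityMeasure (meas u) := by
  refine ⟨?_⟩
  rw [meas, withDensity_apply _ MeasurableSet.univ, Measure.restrict_univ,
    ← ofReal_integral_eq_lintegral_ofReal (integrable_of_continuous h.continuous_descend _)
      (Eventually.of_forall h.descend_nonneg), integral_circ]
  simp only [descend_coe h.c1.2, h.integral, ENNReal.ofReal_one]

lemma CircleCover.continuous_of_lift (c : CircleCover) {f : Circ → Circ}
    (hf : ∀ t : ℝ, f (t : Circ) = ((c.map t : ℝ) : Circ)) : Continuous f := by
  rw [continuous_circ_iff, funext hf]
  exact continuous_coe_circ.comp c.contDiff.continuous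

/-- The transfer operator acts on densities as the push-forward does on measures. -/
lemma CircleCover.map_meas (c : CircleCover) {f : Circ → Circ}
    (hf : ∀ t : ℝ, f (t : Circ) = ((c.map t : ℝ) : Circ)) {K K' : ℝ} {u : ℝ → ℝ} (hu : Dens K u)
    (hu' : Dens K' (c.transfer u)) : (meas u).map f = meas (c.transfer u) := by
  have := hu.isProbabilityMeasure
  have := hu'.isProbabilityMeasure
  have hfc := c.continuous_of_lift hf
  refine ext_of_forall_integral_eq_of_IsFiniteMeasure fun g => ?_
  rw [integral_map hfc.measurable.aemeasurable g.continuous.aestronglyMeasurable,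
    hu.integral_meas, hu'.integral_meas]
  simp only [hf]
  exact c.integral_comp_mul (g := fun t : ℝ => g (t : Circ)) (g.continuous.comp continuous_coe_circ)
    (periodic_coe_circ g) hu.c1.continuous hu.c1.2

lemma CircleCover.integral_comp_iterate (c : CircleCover) {f : Circ → Circ}
    (hf : ∀ t : ℝ, f (t : Circ) = ((c.map t : ℝ) : Circ)) {g : Circ → ℝ} (hg : Continuous g)
    (n : ℕ) : ∀ {u : ℝ → ℝ}, C1Per u → ∫ t in (0 : ℝ)..1, g (f^[n] (t : Circ)) * u t =
      ∫ t in (0 : ℝ)..1, g (t : Circ) * c.transfer^[n] u t := by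
  induction n with
  | zero => intro u _; rfl
  | succ n ih =>
    intro u hu
    have hfc := c.continuous_of_lift hf
    simp only [Function.iterate_succ_apply, hf]
    rw [c.integral_comp_mul (g := fun t : ℝ => g (f^[n] (t : Circ)))
      (hg.comp ((hfc.iterate n).comp continuous_coe_circ))
      (periodic_coe_circ fun x => g (f^[n] x)) hu.continuous hu.2]
    exact ih (c.c1Per_transfer hu)

/-- Continuous functions on the circle are uniform limits of `C¹` functions. -/
lemma exists_C1Per_near {q : Circ → ℝ} (hq : Continuous q) {ε : ℝ} (hε : 0 < ε) :
    ∃ u, C1Per u ∧ ∀ t : ℝ, |q (t : Circ) - u t| ≤ ε := by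
  set p : ℝ → ℝ := fun t => q (t : Circ) with hp
  have hpc : Continuous p := hq.comp continuous_coe_circ
  have hpp : Function.Periodic p 1 := periodic_coe_circ q
  have huc : UniformContinuous p :=
    (CompactSpace.uniformContinuous_of_continuous hq).comp
      (uniformContinuous_of_continuousAt_zero (QuotientAddGroup.mk' (AddSubgroup.zmultiples (1 : ℝ)))
        (AddCircle.continuous_mk' (1 : ℝ)).continuousAt)
  obtain ⟨δ, hδ, hδ'⟩ := Metric.uniformContinuous_iff.1 huc ε hε
  -- The approximant is the moving average over `[t, t + d]`, with `d` below the modulus of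
  -- continuity for `ε`.
  set d := δ / 2 with hd
  have hd0 : 0 < d := by positivity
  have hder : ∀ t, HasDerivAt (fun t => d⁻¹ * ∫ s in t..(t + d), p s) (d⁻¹ * (p (t + d) - p t)) t := by
    intro t
    have h1 : ∀ t, HasDerivAt (fun t => ∫ s in (0 : ℝ)..t, p s) (p t) t := fun t =>
      intervalIntegral.integral_hasDerivAt_right (hpc.intervalIntegrable _ _)
        (hpc.stronglyMeasurableAtFilter _ _) hpc.continuousAt
    have h2 := (((h1 (t + d)).comp_add_const t d).sub (h1 t)).const_mul d⁻¹
    refine h2.congr_of_eventuallyEq (Eventually.of_forall fun x => ?_)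
    simp only [Pi.sub_apply]
    rw [intervalIntegral.integral_interval_sub_left (hpc.intervalIntegrable _ _)
      (hpc.intervalIntegrable _ _)]
  refine ⟨fun t => d⁻¹ * ∫ s in t..(t + d), p s, ⟨contDiff_one_iff_deriv.2
    ⟨fun t => (hder t).differentiableAt, ?_⟩, fun t => ?_⟩, fun t => ?_⟩
  · rw [funext fun t => (hder t).deriv]
    fun_prop
  · have h1 : ∫ s in (t + 1)..(t + 1 + d), p s = ∫ s in t..(t + d), p (s + 1) := by
      rw [intervalIntegral.integral_comp_add_right]; ring_nf
    simp only [h1, funext hpp]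
  · have h1 : p t - d⁻¹ * ∫ s in t..(t + d), p s = d⁻¹ * ∫ s in t..(t + d), (p t - p s) := by
      rw [intervalIntegral.integral_sub (intervalIntegrable_const (μ := volume))
        (hpc.intervalIntegrable _ _), intervalIntegral.integral_const, smul_eq_mul]
      field_simp
      ring
    rw [h1, abs_mul, abs_of_pos (inv_pos.2 hd0)]
    have h2 : ‖∫ s in t..(t + d), (p t - p s)‖ ≤ ε * |t + d - t| := by
      refine intervalIntegral.norm_integral_le_of_norm_le_const fun s hs => ?_
      rw [uIoc_of_le (by linarith)] at hs
      have := hδ' (a := t) (b := s) (by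
        rw [Real.dist_eq, abs_sub_lt_iff]
        constructor <;> linarith [hs.1, hs.2])
      rw [Real.dist_eq] at this
      exact this.le
    rw [Real.norm_eq_abs, add_sub_cancel_left, abs_of_pos hd0] at h2
    rw [inv_mul_le_iff₀ hd0]
    linarith

/-! ### Uniqueness of the absolutely continuous invariant measure. -/

namespace CircleCover

variable {c : CircleCover} {lo C : ℝ}

/-- Exponential convergence to the invariant density. -/
lemma Bounds.exists_tendsto_invariant (hb : c.Bounds lo C) (hlo : 1 < lo) (hn : 0 < c.deg) {D : ℝ}
    (hD : ∀ t, |deriv c.map t| ≤ D) {K : ℝ} {r : ℝ → ℝ} (hr : Dens K r) (hinv : c.transfer r = r)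
    {u : ℝ → ℝ} (hu : C1Per u) : ∃ θ A, 0 ≤ θ ∧ θ < 1 ∧ 0 ≤ A ∧ ∀ n t,
      |c.transfer^[n] u t - (∫ t in (0 : ℝ)..1, u t) * r t| ≤ A * θ ^ n := by
  obtain ⟨M, hM, hMu⟩ := exists_bound_of_periodic hu.continuous hu.2
  set a := ∫ t in (0 : ℝ)..1, u t with ha
  have haM : -M ≤ a := by
    have := intervalIntegral.integral_mono_on zero_le_one
      (intervalIntegrable_const (μ := volume) (c := -M)) (hu.continuous.intervalIntegrable 0 1)
      fun t _ => (abs_le.1 (hMu t)).1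
    simpa using this
  have hpos : 0 < a + 2 * M := by linarith
  -- Since `u` may change sign, it is written as a combination of the density `v` and the constant
  -- density 1, and the decay estimate is applied to both.
  obtain ⟨v, hv⟩ : ∃ v : ℝ → ℝ, v = fun t => (a + 2 * M)⁻¹ * (u t + 2 * M) := ⟨_, rfl⟩
  have hvc : C1Per v := hv ▸ (hu.add (C1Per.const (2 * M))).const_mul _
  have hvd : Dens (l1 (deriv v)) v := by
    refine ⟨hvc, fun t => ?_, ?_, le_rfl⟩
    · rw [hv]
      exact mul_nonneg (inv_pos.2 hpos).le (by linarith [(abs_le.1 (hMu t)).1])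
    · rw [hv, intervalIntegral.integral_const_mul, intervalIntegral.integral_add
        (hu.continuous.intervalIntegrable _ _) (intervalIntegrable_const (μ := volume)), ← ha]
      simp [hpos.ne']
  set K' := max K (l1 (deriv v))
  obtain ⟨θ, A, hθ, hθ1, hA, H⟩ := hb.exists_decay hlo hn hD K'
  have hfix : ∀ n, c.transfer^[n] r = r := fun n => Function.iterate_fixed hinv n
  have hr' : Dens K' r := hr.mono (le_max_left _ _)
  have h1 : Dens K' fun _ => 1 := Dens.one.mono (hr.nonneg_var.trans (le_max_left _ _))
  refine ⟨θ, (a + 2 * M) * A + 2 * M * A, (inv_pos.2 hb.pos).le.trans hθ.le, hθ1, by positivity,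
    fun n t => ?_⟩
  have hu2 : c.transfer^[n] u = fun t => (a + 2 * M) * c.transfer^[n] v t -
      2 * M * c.transfer^[n] (fun _ => 1) t := by
    have := c.iterate_sub (fun t => (a + 2 * M) * v t) (fun _ => 2 * M * 1) n
    rw [c.iterate_const_mul, c.iterate_const_mul (2 * M) fun _ => 1] at this
    rw [← this]
    congr 1
    funext t
    simp only [hv]
    field_simp
    ring
  have e1 : c.transfer^[n] u t - a * r t = (a + 2 * M) * (c.transfer^[n] v t - c.transfer^[n] r t)
      - 2 * M * (c.transfer^[n] (fun _ => 1) t - c.transfer^[n] r t) := by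
    rw [hu2, hfix]
    ring
  rw [e1]
  refine (abs_sub _ _).trans ?_
  rw [abs_mul, abs_mul, abs_of_pos hpos, abs_of_pos (by positivity : 0 < 2 * M), add_mul _ _ (θ ^ n)]
  refine add_le_add ?_ ?_
  · rw [mul_assoc]
    exact mul_le_mul_of_nonneg_left (H n v r (hvd.mono (le_max_right _ _)) hr' t) hpos.le
  · rw [mul_assoc (2 * M)]
    exact mul_le_mul_of_nonneg_left (H n _ r h1 hr' t) (by positivity)

/-- The absolutely continuous invariant probability measure is unique. -/
lemma Bounds.eq_meas_of_invariant (hb : c.Bounds lo C) (hlo : 1 < lo) (hn : 0 < c.deg) {D : ℝ}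
    (hD : ∀ t, |deriv c.map t| ≤ D) {K : ℝ} {r : ℝ → ℝ} (hr : Dens K r) (hinv : c.transfer r = r)
    {f : Circ → Circ} (hf : ∀ t : ℝ, f (t : Circ) = ((c.map t : ℝ) : Circ)) {μ : Measure Circ}
    [IsProbabilityMeasure μ] (hac : μ ≪ volume) (hμ : μ.map f = μ) : μ = meas r := by
  have := hr.isProbabilityMeasure
  have hfc := c.continuous_of_lift hf
  have hmp : MeasurePreserving f μ μ := ⟨hfc.measurable, hμ⟩
  refine ext_of_forall_integral_eq_of_IsFiniteMeasure fun g => ?_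
  have hgb : ∀ x, |g x| ≤ ‖g‖ := fun x => g.norm_coe_le_norm x
  set I := ∫ x, g x ∂(meas r) with hI
  have hIb : |I| ≤ ‖g‖ := by
    have := norm_integral_le_of_norm_le_const (μ := meas r) (f := g) (C := ‖g‖)
      (Eventually.of_forall hgb)
    simpa using this
  set ρ : Circ → ℝ := fun x => (μ.rnDeriv volume x).toReal with hρ
  have hρi : Integrable ρ := Measure.integrable_toReal_rnDeriv
  have hρμ : ∀ φ : Circ → ℝ, ∫ x, φ x ∂μ = ∫ x, ρ x * φ x := fun φ =>
    (integral_rnDeriv_smul hac (f := φ)).symm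
  -- One `2 * ε` pays for replacing the density of `μ` by a `C¹` function `u`, the other for the
  -- resulting mass defect `|1 - a|`.
  have key : ∀ ε > 0, |∫ x, g x ∂μ - I| ≤ 4 * ε * ‖g‖ := by
    intro ε hε
    obtain ⟨q, hq, hqi⟩ := hρi.exists_boundedContinuous_integral_sub_le hε
    obtain ⟨u, hu, hqu⟩ := exists_C1Per_near q.continuous hε
    have hduc := continuous_descend hu.continuous hu.2
    have hdi := integrable_of_continuous hduc volume
    have hvol : (volume : Measure Circ).real univ = 1 := by
      simp [measureReal_def]
    have hdist : ∫ x, |ρ x - descend u x| ≤ 2 * ε := by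
      have h1 : ∀ x, |ρ x - descend u x| ≤ ‖ρ x - q x‖ + ε := by
        intro x
        obtain ⟨t, rfl⟩ := QuotientAddGroup.mk_surjective x
        have h2 := hqu t
        have h3 := abs_sub_le (ρ (t : Circ)) (q (t : Circ)) (descend u (t : Circ))
        rw [descend_coe hu.2] at h3
        refine (le_of_eq ?_).trans (h3.trans (add_le_add le_rfl h2))
        rw [← descend_coe hu.2]
      refine (integral_mono (hρi.sub hdi).abs ((hρi.sub hqi).norm.add (integrable_const ε)) h1).trans ?_
      refine (integral_add (f := fun x => ‖ρ x - q x‖) (hρi.sub hqi).norm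
        (integrable_const ε)).trans_le ?_
      rw [integral_const, hvol]
      simp only [smul_eq_mul, one_mul]
      linarith
    have hd : ∀ φ : Circ → ℝ, Continuous φ → (∀ x, |φ x| ≤ ‖g‖) →
        |∫ x, φ x ∂μ - ∫ t in (0 : ℝ)..1, φ (t : Circ) * u t| ≤ 2 * ε * ‖g‖ := by
      intro φ hφ hφb
      have h1 : ∫ t in (0 : ℝ)..1, φ (t : Circ) * u t = ∫ x, descend u x * φ x := by
        rw [integral_circ]
        simp only [descend_coe hu.2, mul_comm]
      have hi1 : Integrable fun x => ρ x * φ x :=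
        hρi.mul_bdd hφ.aestronglyMeasurable (Eventually.of_forall hφb)
      have hi2 : Integrable fun x => descend u x * φ x :=
        integrable_of_continuous (hduc.mul hφ) _
      rw [hρμ, h1, ← integral_sub hi1 hi2, ← Real.norm_eq_abs]
      refine (norm_integral_le_integral_norm _).trans ?_
      refine (integral_mono (hi1.sub hi2).norm ((hρi.sub hdi).abs.mul_const ‖g‖) fun x => ?_).trans ?_
      · simp only [Pi.sub_apply, ← sub_mul, norm_mul, Real.norm_eq_abs (φ x)]
        exact mul_le_mul_of_nonneg_left (hφb x) (norm_nonneg _)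
      · rw [integral_mul_const]
        exact mul_le_mul_of_nonneg_right hdist (norm_nonneg _)
    set a := ∫ t in (0 : ℝ)..1, u t with ha
    have ha1 : |1 - a| ≤ 2 * ε := by
      have h1 : ∫ x, ρ x = 1 := by
        have := hρμ fun _ => 1
        simpa using this.symm
      have h2 : ∫ x, descend u x = a := by
        rw [integral_circ]; simp only [descend_coe hu.2, ha]
      rw [← h1, ← h2, ← integral_sub hρi hdi, ← Real.norm_eq_abs]
      exact (norm_integral_le_integral_norm _).trans hdist
    have hlim : Tendsto (fun n => ∫ t in (0 : ℝ)..1, g (t : Circ) * c.transfer^[n] u t) atTop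
        (𝓝 (a * I)) := by
      obtain ⟨θ, A, hθ, hθ1, hA, H⟩ := hb.exists_tendsto_invariant hlo hn hD hr hinv hu
      have hgc : Continuous fun t : ℝ => g (t : Circ) := g.continuous.comp continuous_coe_circ
      have h1 : ∀ n, |(∫ t in (0 : ℝ)..1, g (t : Circ) * c.transfer^[n] u t) - a * I| ≤
          ‖g‖ * A * θ ^ n := by
        intro n
        have hPc := (c.c1Per_iterate hu n).continuous
        rw [hI, hr.integral_meas, ← intervalIntegral.integral_const_mul,
          ← intervalIntegral.integral_sub (f := fun t : ℝ => g (t : Circ) * c.transfer^[n] u t)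
            (g := fun t : ℝ => a * (g (t : Circ) * r t)) ((hgc.mul hPc).intervalIntegrable _ _)
            (((hgc.mul hr.c1.continuous).const_mul a).intervalIntegrable _ _), ← Real.norm_eq_abs]
        have h2 : ∀ t ∈ uIoc (0 : ℝ) 1, ‖g (t : Circ) * c.transfer^[n] u t -
            a * (g (t : Circ) * r t)‖ ≤ ‖g‖ * A * θ ^ n := by
          intro t _
          have : g (t : Circ) * c.transfer^[n] u t - a * (g (t : Circ) * r t) =
            g (t : Circ) * (c.transfer^[n] u t - a * r t) := by ring
          rw [this, norm_mul, mul_assoc]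
          exact mul_le_mul (hgb _) (H n t) (norm_nonneg _) (norm_nonneg _)
        simpa using intervalIntegral.norm_integral_le_of_norm_le_const h2
      rw [tendsto_iff_norm_sub_tendsto_zero]
      refine squeeze_zero (fun _ => norm_nonneg _) h1 ?_
      simpa using (tendsto_pow_atTop_nhds_zero_of_lt_one hθ hθ1).const_mul (‖g‖ * A)
    -- Invariance leaves the integral against `μ` unchanged when `g` becomes `g ∘ f^[n]`, while
    -- duality moves the iterates onto `u`; the error is independent of `n`.
    have h1 : ∀ n, |∫ x, g x ∂μ - ∫ t in (0 : ℝ)..1, g (t : Circ) * c.transfer^[n] u t| ≤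
        2 * ε * ‖g‖ := by
      intro n
      have h2 := hd (fun x => g (f^[n] x)) (g.continuous.comp (hfc.iterate n)) fun x => hgb _
      rw [c.integral_comp_iterate hf g.continuous n hu] at h2
      have h3 : ∫ x, g (f^[n] x) ∂μ = ∫ x, g x ∂μ := by
        rw [← integral_map (hfc.iterate n).measurable.aemeasurable
          g.continuous.aestronglyMeasurable, (hmp.iterate n).map_eq]
      rwa [h3] at h2
    have h2 : |∫ x, g x ∂μ - a * I| ≤ 2 * ε * ‖g‖ :=
      le_of_tendsto' (tendsto_const_nhds.sub hlim).abs h1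
    have h3 : |a * I - I| ≤ 2 * ε * ‖g‖ := by
      have : a * I - I = -((1 - a) * I) := by ring
      rw [this, abs_neg, abs_mul]
      exact mul_le_mul ha1 hIb (abs_nonneg _) (by positivity)
    have := abs_sub_le (∫ x, g x ∂μ) (a * I) I
    linarith
  have hz : |∫ x, g x ∂μ - I| ≤ 0 := by
    refine le_of_forall_pos_le_add fun ε hε => ?_
    have h1 := key (ε / (4 * (‖g‖ + 1))) (by positivity)
    refine h1.trans ?_
    have hg0 := norm_nonneg g
    rw [zero_add, show 4 * (ε / (4 * (‖g‖ + 1))) * ‖g‖ = ε * (‖g‖ / (‖g‖ + 1)) by field_simp]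
    refine mul_le_of_le_one_right hε.le ?_
    rw [div_le_one (by positivity)]
    linarith
  exact sub_eq_zero.1 (abs_nonpos_iff.1 hz)

end CircleCover

/-! ### Averaged interactions and the near-identity maps they produce. -/

/-- Kernels of class `C^n` on the torus, with the first variable lifted to the line. -/
def PerKer (n : ℕ) (k : ℝ → Circ → ℝ) : Prop :=
  ContDiff ℝ n (fun p : ℝ × ℝ => k p.1 (p.2 : Circ)) ∧ ∀ t y, k (t + 1) y = k t y

namespace PerKer

variable {n : ℕ} {k : ℝ → Circ → ℝ}

lemma continuous_right (hk : PerKer n k) (t : ℝ) : Continuous (k t) := by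
  rw [continuous_circ_iff]
  exact hk.1.continuous.comp (by fun_prop : Continuous fun s : ℝ => (t, s))

lemma continuous_left (hk : PerKer n k) (y : Circ) : Continuous fun t => k t y := by
  obtain ⟨s, rfl⟩ := QuotientAddGroup.mk_surjective y
  exact hk.1.continuous.comp (by fun_prop : Continuous fun t : ℝ => (t, s))

lemma hasDerivAt (hk : PerKer (n + 1) k) (t s : ℝ) :
    HasDerivAt (fun τ => k τ (s : Circ))
      (fderiv ℝ (fun p : ℝ × ℝ => k p.1 (p.2 : Circ)) (t, s) (1, 0)) t := by
  have h1 := (hk.1.differentiable (by simp) (t, s)).hasFDerivAt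
  exact h1.comp_hasDerivAt t ((hasDerivAt_id t).prodMk (hasDerivAt_const t s))

lemma deriv (hk : PerKer (n + 1) k) : PerKer n fun t y => deriv (fun τ => k τ y) t := by
  refine ⟨?_, fun t y => ?_⟩
  · simp only [(hk.hasDerivAt _ _).deriv]
    exact (hk.1.fderiv_right (m := n) (by norm_cast)).clm_apply contDiff_const
  · exact periodic_deriv (u := fun τ => k τ y) (fun τ => hk.2 τ y) t

lemma exists_bound (hk : PerKer n k) : ∃ C, 0 < C ∧ ∀ t y, |k t y| ≤ C := by
  obtain ⟨C, hC⟩ := ((isCompact_Icc (a := (0 : ℝ)) (b := 1)).prod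
    (isCompact_Icc (a := (0 : ℝ)) (b := 1))).exists_bound_of_continuousOn hk.1.continuous.continuousOn
  refine ⟨max C 1, by positivity, fun t y => ?_⟩
  obtain ⟨s, rfl⟩ := QuotientAddGroup.mk_surjective y
  obtain ⟨s', hs', hs⟩ := (periodic_coe_circ (k t)).exists_mem_Ico₀ one_pos s
  have hper : Function.Periodic (fun τ => k τ (s' : Circ)) 1 := fun τ => hk.2 τ _
  obtain ⟨t', ht', ht⟩ := hper.exists_mem_Ico₀ one_pos t
  exact ((congrArg abs (hs.trans ht)).le.trans
    (hC (t', s') ⟨⟨ht'.1, ht'.2.le⟩, ⟨hs'.1, hs'.2.le⟩⟩)).trans (le_max_left _ _)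

lemma hasDerivAt_integral (hk : PerKer (n + 1) k) (μ : Measure Circ) [IsProbabilityMeasure μ]
    (t : ℝ) : HasDerivAt (fun t => ∫ y, k t y ∂μ) (∫ y, _root_.deriv (fun τ => k τ y) t ∂μ) t := by
  obtain ⟨C, -, hC⟩ := hk.deriv.exists_bound
  refine (hasDerivAt_integral_of_dominated_loc_of_deriv_le (bound := fun _ => C) (s := univ)
    univ_mem (Eventually.of_forall fun t => (hk.continuous_right t).aestronglyMeasurable)
    (integrable_of_continuous (hk.continuous_right t) μ)
    (hk.deriv.continuous_right t).aestronglyMeasurable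
    (Eventually.of_forall fun y t _ => hC t y) (integrable_const C)
    (Eventually.of_forall fun y t _ => ?_)).2
  obtain ⟨s, rfl⟩ := QuotientAddGroup.mk_surjective y
  exact (hk.hasDerivAt t s).differentiableAt.hasDerivAt

lemma continuous_integral (hk : PerKer n k) (μ : Measure Circ) [IsProbabilityMeasure μ] :
    Continuous fun t => ∫ y, k t y ∂μ := by
  obtain ⟨C, -, hC⟩ := hk.exists_bound
  exact continuous_of_dominated (fun t => (hk.continuous_right t).aestronglyMeasurable)
    (fun t => Eventually.of_forall fun y => hC t y) (integrable_const C)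
    (Eventually.of_forall fun y => hk.continuous_left y)

end PerKer

lemma abs_integral_le_of_prob {X : Type*} [MeasurableSpace X] {μ : Measure X}
    [IsProbabilityMeasure μ] {g : X → ℝ} {C : ℝ} (h : ∀ y, |g y| ≤ C) : |∫ y, g y ∂μ| ≤ C := by
  simpa using norm_integral_le_of_norm_le_const (μ := μ) (f := g) (C := C)
    (Eventually.of_forall fun y => h y)

/-- Averages of a `C²` interaction function are bounded in `C²` uniformly in the measure. -/
lemma IsC2₂.exists_bound {h : Circ → Circ → ℝ} (hh : IsC2₂ h) : ∃ C, 0 < C ∧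
    ∀ μ : Measure Circ, IsProbabilityMeasure μ → ContDiff ℝ 2 (fun t : ℝ => ∫ y, h t y ∂μ) ∧
      ∀ t : ℝ, |∫ y, h (t : Circ) y ∂μ| ≤ C ∧ |deriv (fun t : ℝ => ∫ y, h t y ∂μ) t| ≤ C ∧
        |deriv (deriv fun t : ℝ => ∫ y, h t y ∂μ) t| ≤ C := by
  have hk : PerKer 2 fun t y => h t y := ⟨hh, fun t y => periodic_coe_circ (fun x => h x y) t⟩
  obtain ⟨C₀, h0, hC₀⟩ := hk.exists_bound
  obtain ⟨C₁, h1, hC₁⟩ := hk.deriv.exists_bound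
  obtain ⟨C₂, h2, hC₂⟩ := hk.deriv.deriv.exists_bound
  refine ⟨max C₀ (max C₁ C₂), lt_max_of_lt_left h0, fun μ hμ => ?_⟩
  have d1 : (deriv fun t : ℝ => ∫ y, h t y ∂μ) =
      fun t => ∫ y, deriv (fun τ : ℝ => h τ y) t ∂μ :=
    funext fun t => (hk.hasDerivAt_integral μ t).deriv
  have d2 : deriv (deriv fun t : ℝ => ∫ y, h t y ∂μ) =
      fun t => ∫ y, deriv (fun τ => deriv (fun τ : ℝ => h τ y) τ) t ∂μ := by
    rw [d1]
    exact funext fun t => (hk.deriv.hasDerivAt_integral μ t).deriv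
  refine ⟨?_, fun t => ⟨?_, ?_, ?_⟩⟩
  · rw [show (2 : WithTop ℕ∞) = 1 + 1 by norm_num, contDiff_succ_iff_deriv]
    refine ⟨fun t => (hk.hasDerivAt_integral μ t).differentiableAt, by simp, ?_⟩
    rw [contDiff_one_iff_deriv, d2, d1]
    exact ⟨fun t => (hk.deriv.hasDerivAt_integral μ t).differentiableAt,
      hk.deriv.deriv.continuous_integral μ⟩
  · exact (abs_integral_le_of_prob fun y => hC₀ t y).trans (le_max_left _ _)
  · rw [d1]
    exact (abs_integral_le_of_prob fun y => hC₁ t y).trans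
      ((le_max_left _ _).trans (le_max_right _ _))
  · rw [d2]
    exact (abs_integral_le_of_prob fun y => hC₂ t y).trans
      ((le_max_right _ _).trans (le_max_right _ _))

/-- A degree one cover that is `C²`-close to the identity. -/
structure CircleCover.NearId (b : CircleCover) (e : ℝ) : Prop where
  sgn : b.sgn = 1
  deg : b.deg = 1
  map_sub : ∀ t, |b.map t - t| ≤ e
  deriv_sub : ∀ t, |deriv b.map t - 1| ≤ e
  bounds : b.Bounds (1 - e) (4 * e)

lemma exists_nearId {g : ℝ → ℝ} (hg : ContDiff ℝ 2 g) (hp : Function.Periodic g 1) {e : ℝ}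
    (he : e ≤ 1 / 2) (h0 : ∀ t, |g t| ≤ e) (h1 : ∀ t, |deriv g t| ≤ e)
    (h2 : ∀ t, |deriv (deriv g) t| ≤ e) :
    ∃ b : CircleCover, (∀ t, b.map t = t + g t) ∧ b.NearId e := by
  have he0 : 0 ≤ e := (abs_nonneg _).trans (h0 0)
  have hd : deriv (fun t => t + g t) = fun t => 1 + deriv g t := funext fun t => by
    simpa using deriv_fun_add (differentiableAt_id (x := t)) (hg.differentiable (by norm_num) t)
  obtain ⟨b, hbm, hbs, hbn⟩ := CircleCover.exists_of_lift (G := fun t => t + g t) (s := 1)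
    (lo := 1 - e) (n := 1) (contDiff_id.add hg) (Or.inl rfl) (by linarith)
    (fun t => by rw [hd]; linarith [(abs_le.1 (h1 t)).1])
    (fun t => by rw [hp t]; push_cast; ring)
  refine ⟨b, fun t => by rw [hbm], hbs, hbn, fun t => ?_, fun t => ?_, by linarith, by linarith,
    fun t => ?_, fun t => ?_⟩
  · simpa [hbm] using h0 t
  · simpa [hbm, hd] using h1 t
  · rw [hbs, hbm, hd]; linarith [(abs_le.1 (h1 t)).1]
  · rw [hbm, hd, deriv_const_add]
    refine (h2 t).trans ?_
    have h3 := (abs_le.1 (h1 t)).1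
    -- The distortion constant `4 * e` comes from this lower bound `1 / 4`.
    have h4 : (1 / 2) ^ 2 ≤ (1 + deriv g t) ^ 2 := pow_le_pow_left₀ (by norm_num) (by linarith) 2
    calc e = 4 * e * (1 / 2) ^ 2 := by ring
      _ ≤ _ := mul_le_mul_of_nonneg_left h4 (by linarith)

lemma CircleCover.NearId.nonneg {b : CircleCover} {e : ℝ} (h : b.NearId e) : 0 ≤ e :=
  (abs_nonneg _).trans (h.map_sub 0)

lemma perturbedExample_map₁ (f : Circ → Circ) (φ ψ : Circ → ℝ) (α : ℝ) (h₁₁ h₁₂ : Circ → Circ → ℝ)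
    (ε : ℝ) (s : State) (x : Circ) : (perturbedExample f φ ψ α h₁₁ h₁₂ ε).map₁ s x =
      f (x + ((ε * (∫ y, h₁₁ x y ∂s.1 + ∫ y, h₁₂ x y ∂s.2) : ℝ) : Circ)) := by
  simp only [Network.map₁, perturbedExample, integral_const_mul, mul_add]

lemma perturbedExample_map₂ (f : Circ → Circ) (φ ψ : Circ → ℝ) (α : ℝ) (h₁₁ h₁₂ : Circ → Circ → ℝ)
    (ε : ℝ) (s : State) (x : Circ) : (perturbedExample f φ ψ α h₁₁ h₁₂ ε).map₂ s x =
      f (x + ((α * (∫ y, ψ y ∂s.1) * φ x : ℝ) : Circ)) := by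
  simp only [Network.map₂, perturbedExample, integral_const_mul, integral_zero, add_zero]
  congr 3
  ring

/-- The first cluster is driven by `f` composed with a near-identity cover. -/
lemma exists_nearId_of_interaction {h₁₁ h₁₂ : Circ → Circ → ℝ} (hh₁ : IsC2₂ h₁₁) (hh₂ : IsC2₂ h₁₂) :
    ∃ C, 0 < C ∧ ∀ ε : ℝ, |ε| * C ≤ 1 / 2 → ∀ μ ν : Measure Circ, IsProbabilityMeasure μ →
      IsProbabilityMeasure ν → ∃ b : CircleCover, b.NearId (|ε| * C) ∧ ∀ t : ℝ,
        ((b.map t : ℝ) : Circ) =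
          t + ((ε * (∫ y, h₁₁ t y ∂μ + ∫ y, h₁₂ t y ∂ν) : ℝ) : Circ) := by
  obtain ⟨C₁, hC₁, H₁⟩ := hh₁.exists_bound
  obtain ⟨C₂, hC₂, H₂⟩ := hh₂.exists_bound
  refine ⟨C₁ + C₂, by linarith, fun ε hε μ ν hμ hν => ?_⟩
  obtain ⟨hg₁, B₁⟩ := H₁ μ hμ
  obtain ⟨hg₂, B₂⟩ := H₂ ν hν
  set g₁ : ℝ → ℝ := fun t => ∫ y, h₁₁ t y ∂μ
  set g₂ : ℝ → ℝ := fun t => ∫ y, h₁₂ t y ∂ν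
  have hd₁ := hg₁.differentiable (by norm_num)
  have hd₂ := hg₂.differentiable (by norm_num)
  have hdd : ∀ {g : ℝ → ℝ}, ContDiff ℝ 2 g → Differentiable ℝ (deriv g) := fun hg =>
    (((contDiff_succ_iff_deriv (n := 1)).1 hg).2.2).differentiable (by norm_num)
  have e1 : (deriv fun t => ε * (g₁ t + g₂ t)) = fun t => ε * (deriv g₁ t + deriv g₂ t) :=
    funext fun t => by
      rw [deriv_const_mul _ ((hd₁ t).fun_add (hd₂ t)), deriv_fun_add (hd₁ t) (hd₂ t)]
  have e2 : deriv (deriv fun t => ε * (g₁ t + g₂ t)) =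
      fun t => ε * (deriv (deriv g₁) t + deriv (deriv g₂) t) :=
    funext fun t => by
      rw [e1, deriv_const_mul _ ((hdd hg₁ t).fun_add (hdd hg₂ t)),
        deriv_fun_add (hdd hg₁ t) (hdd hg₂ t)]
  have hb : ∀ {x y : ℝ}, |x| ≤ C₁ → |y| ≤ C₂ → |ε * (x + y)| ≤ |ε| * (C₁ + C₂) := fun hx hy => by
    rw [abs_mul]
    exact mul_le_mul_of_nonneg_left ((abs_add_le _ _).trans (add_le_add hx hy)) (abs_nonneg _)
  obtain ⟨b, hbm, hbn⟩ := exists_nearId (g := fun t => ε * (g₁ t + g₂ t))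
    (contDiff_const.mul (hg₁.add hg₂))
    (periodic_coe_circ fun x => ε * (∫ y, h₁₁ x y ∂μ + ∫ y, h₁₂ x y ∂ν)) hε
    (fun t => hb (B₁ t).1 (B₂ t).1)
    (fun t => by rw [e1]; exact hb (B₁ t).2.1 (B₂ t).2.1)
    (fun t => by rw [e2]; exact hb (B₁ t).2.2 (B₂ t).2.2)
  exact ⟨b, hbn, fun t => by rw [hbm, AddCircle.coe_add]⟩

/-! ### The balls `c1Ball` in terms of periodic densities. -/

lemma l1Dist_meas {K K' : ℝ} {u v : ℝ → ℝ} (hu : Dens K u) (hv : Dens K' v) :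
    l1Dist (meas u) (meas v) = l1 fun t => u t - v t := by
  have h : ∀ {K : ℝ} {u : ℝ → ℝ}, Dens K u →
      ∀ᵐ x, ((meas u).rnDeriv volume x).toReal = descend u x := fun hu => by
    filter_upwards [Measure.rnDeriv_withDensity volume
      hu.continuous_descend.measurable.ennreal_ofReal] with x hx
    rw [meas, hx, ENNReal.toReal_ofReal (hu.descend_nonneg x)]
  have h1 : l1Dist (meas u) (meas v) = ∫ x, |descend u x - descend v x| :=
    integral_congr_ae (by filter_upwards [h hu, h hv] with x hx hx'; rw [hx, hx'])
  rw [h1, integral_circ]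
  simp only [descend_coe hu.c1.2, descend_coe hv.c1.2, l1]

/-- Membership in the balls of `C¹` densities in terms of periodic functions. -/
lemma mem_c1Ball_iff {K' K ρ : ℝ} {r : ℝ → ℝ} (hr : Dens K' r) {μ : Measure Circ} :
    μ ∈ c1Ball (meas r) K ρ ↔ ∃ u, Dens (K - 1) u ∧ μ = meas u ∧ l1 (fun t => u t - r t) < ρ := by
  constructor
  · rintro ⟨hμ, ⟨d, ⟨hd, hd0, rfl⟩, hK⟩, hl⟩
    have hper := periodic_coe_circ d
    have hdesc : descend (fun t : ℝ => d t) = d := funext fun x => by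
      obtain ⟨t, rfl⟩ := QuotientAddGroup.mk_surjective x
      exact descend_coe hper t
    have hdc : Continuous d := continuous_circ_iff.2 hd.continuous
    have hm : volume.withDensity (fun x => ENNReal.ofReal (d x)) = meas fun t : ℝ => d t := by
      rw [meas, hdesc]
    have hint : ∫ x, d x = 1 := by
      have h1 := hμ.measure_univ
      rwa [withDensity_apply _ MeasurableSet.univ, Measure.restrict_univ,
        ← ofReal_integral_eq_lintegral_ofReal (integrable_of_continuous hdc _)
          (Eventually.of_forall hd0), ENNReal.ofReal_eq_one] at h1
    have hu : Dens (K - 1) fun t : ℝ => d t := by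
      refine ⟨⟨hd, hper⟩, fun t => hd0 _, by rw [← integral_circ, hint], ?_⟩
      have h2 : ∫ x, |d x| = 1 := by simp only [abs_of_nonneg (hd0 _), hint]
      rw [strongNorm, h2] at hK
      rw [l1]
      linarith
    refine ⟨_, hu, hm, ?_⟩
    rwa [hm, l1Dist_meas hu hr] at hl
  · rintro ⟨u, hu, rfl, hl⟩
    refine ⟨hu.isProbabilityMeasure, ⟨descend u, ⟨?_, hu.descend_nonneg, rfl⟩, ?_⟩, ?_⟩
    · simpa only [descend_coe hu.c1.2] using hu.c1.1
    · rw [strongNorm, integral_circ]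
      simp only [descend_coe hu.c1.2]
      have h1 := hu.l1_eq
      have h2 := hu.var_le
      rw [l1] at h1 h2
      rw [h1]
      linarith
    · rwa [l1Dist_meas hu hr]

/-! ### Stability of the first cluster under perturbation. -/

namespace CircleCover

variable {c : CircleCover} {lo C : ℝ}

/-- The perturbed transfer operator preserves densities of bounded variation. -/
lemma Bounds.dens_perturbed (hb : c.Bounds lo C) (hlo : 1 < lo) {b : CircleCover} {e V : ℝ}
    (hbe : b.NearId e) (he : e ≤ 1 / 2) (he' : 12 * e ≤ 1 - lo⁻¹) (hV : 1 ≤ V)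
    (hVC : 2 * C ≤ (1 - lo⁻¹) * V) {u : ℝ → ℝ} (hu : Dens V u) :
    Dens V (c.transfer (b.transfer u)) := by
  refine (hb.dens_transfer (hbe.bounds.dens_transfer hu)).mono ?_
  have hl1 : lo⁻¹ < 1 := inv_lt_one_of_one_lt₀ hlo
  have hl0 : 0 < lo⁻¹ := inv_pos.2 hb.pos
  have he0 := hbe.nonneg
  have h1 : (1 - e)⁻¹ ≤ 1 + 2 * e := by
    rw [inv_le_iff_one_le_mul₀ (by linarith)]
    nlinarith
  -- The slack `(1 - lo⁻¹) * V` is shared equally: half absorbs `6 * e * V`, half absorbs `C`.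
  have h2 : (1 - e)⁻¹ * V + 4 * e ≤ V + 6 * e * V := by
    nlinarith [mul_le_mul_of_nonneg_right h1 (by linarith : 0 ≤ V), mul_le_mul_of_nonneg_left hV he0]
  have h3 := mul_le_mul_of_nonneg_left h2 hl0.le
  have h4 : lo⁻¹ * (6 * e * V) ≤ 6 * e * V :=
    mul_le_of_le_one_left (by positivity) hl1.le
  have h5 := mul_le_mul_of_nonneg_right he' (by linarith : 0 ≤ V)
  linarith

lemma l1_perturbed_sub_le (c : CircleCover) {b : CircleCover} {e V : ℝ} (hbe : b.NearId e)
    (he : e ≤ 1 / 2) {u : ℝ → ℝ} (hu : Dens V u) :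
    l1 (fun t => c.transfer (b.transfer u) t - c.transfer u t) ≤ e * (4 * V + 2) := by
  have hbu := (b.c1Per_transfer hu.c1).sub hu.c1
  rw [← c.transfer_sub]
  refine (c.l1_transfer_le hbu.continuous hbu.2).trans
    ((b.l1_transfer_sub_le hbe.sgn hbe.deg he hbe.map_sub hbe.deriv_sub hu.c1).trans ?_)
  rw [hu.l1_eq]
  have := hu.var_le
  have := hbe.nonneg
  gcongr
  linarith

/-- The operator does not increase the `L¹` norm, so one-step errors only add up. -/
lemma l1_shadow_le (c : CircleCover) {u : ℕ → ℝ → ℝ} (hu : ∀ n, C1Per (u n)) {E : ℝ}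
    (h : ∀ n, l1 (fun t => u (n + 1) t - c.transfer (u n) t) ≤ E) (n j : ℕ) :
    l1 (fun t => u (n + j) t - c.transfer^[j] (u n) t) ≤ j * E := by
  induction j with
  | zero => simp [l1]
  | succ j ih =>
    have hP := c.c1Per_iterate (hu n) j
    have h1 := l1_sub_le (hu (n + j + 1)).continuous (c.c1Per_transfer (hu (n + j))).continuous
      (c.c1Per_transfer hP).continuous
    rw [← c.transfer_sub] at h1
    have h2 := c.l1_transfer_le ((hu (n + j)).sub hP).continuous ((hu (n + j)).sub hP).2
    rw [Function.iterate_succ_apply', ← add_assoc]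
    push_cast
    linarith [h (n + j)]

/-- Pseudo-orbits of the transfer operator stay close to the invariant density. -/
lemma l1_pseudoOrbit_lt (c : CircleCover) {r : ℝ → ℝ} (hr : C1Per r) (hinv : c.transfer r = r)
    {u : ℕ → ℝ → ℝ} (hu : ∀ n, C1Per (u n)) {E δ : ℝ} {N : ℕ} (hE : 0 ≤ E)
    (h : ∀ n, l1 (fun t => u (n + 1) t - c.transfer (u n) t) ≤ E) (hNE : N * E < δ / 4)
    (hN : ∀ n, l1 (fun t => c.transfer^[N] (u n) t - r t) ≤ δ / 4)
    (h0 : l1 (fun t => u 0 t - r t) < δ / 2) (n : ℕ) : l1 (fun t => u n t - r t) < δ := by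
  -- Up to time `N` the initial distance does not grow under the exact dynamics; later, the
  -- comparison orbit is restarted at time `n - N`.
  rcases le_total n N with hn | hn
  · have h1 := c.l1_shadow_le hu h 0 n
    rw [zero_add] at h1
    have hP := c.c1Per_iterate (hu 0) n
    have h2 := l1_sub_le (hu n).continuous hP.continuous hr.continuous
    have h3 := c.l1_iterate_le ((hu 0).sub hr) n
    rw [c.iterate_sub, Function.iterate_fixed hinv] at h3
    have h4 : (n : ℝ) * E ≤ N * E := mul_le_mul_of_nonneg_right (by exact_mod_cast hn) hE
    have h5 := l1_nonneg fun t => u 0 t - r t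
    linarith
  · obtain ⟨k, rfl⟩ := Nat.exists_eq_add_of_le' hn
    have h1 := c.l1_shadow_le hu h k N
    have h2 := l1_sub_le (hu (k + N)).continuous (c.c1Per_iterate (hu k) N).continuous hr.continuous
    have h3 := hN k
    have h4 : 0 ≤ (N : ℝ) * E := by positivity
    linarith

end CircleCover

/-! ### Contraction of the second cluster and Wasserstein distance to synchrony. -/

lemma abs_integral_meas_sub_le {K K' : ℝ} {u v : ℝ → ℝ} (hu : Dens K u) (hv : Dens K' v)
    {g : Circ → ℝ} (hg : Continuous g) {M : ℝ} (hM : ∀ t : ℝ, |g (t : Circ)| ≤ M) :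
    |∫ y, g y ∂(meas u) - ∫ y, g y ∂(meas v)| ≤ M * l1 fun t => u t - v t := by
  have hgc : Continuous fun t : ℝ => g (t : Circ) := hg.comp continuous_coe_circ
  have huc := hu.c1.continuous
  have hvc := hv.c1.continuous
  rw [hu.integral_meas, hv.integral_meas, ← intervalIntegral.integral_sub
    (f := fun t : ℝ => g (t : Circ) * u t) (g := fun t : ℝ => g (t : Circ) * v t)
    ((hgc.mul huc).intervalIntegrable _ _) ((hgc.mul hvc).intervalIntegrable _ _), l1,
    ← intervalIntegral.integral_const_mul]
  refine (abs_integral_le_l1 _).trans (l1_mono (by fun_prop) (by fun_prop) fun t => ?_)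
  rw [← mul_sub, abs_mul]
  exact mul_le_mul_of_nonneg_right (hM t) (abs_nonneg _)

lemma norm_coe_circ_le (x : ℝ) : ‖(x : Circ)‖ ≤ |x| := by
  rw [UnitAddCircle.norm_eq]
  simpa using round_le x 0

lemma exists_coe_eq_abs_eq_norm (x : Circ) : ∃ t : ℝ, (t : Circ) = x ∧ |t| = ‖x‖ := by
  obtain ⟨s, rfl⟩ := QuotientAddGroup.mk_surjective x
  refine ⟨s - round s, ?_, UnitAddCircle.norm_eq.symm⟩
  have h : ((round s : ℝ) : Circ) = 0 := (AddCircle.coe_eq_zero_iff (1 : ℝ)).2 ⟨round s, by simp⟩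
  rw [AddCircle.coe_sub, h, sub_zero]

/-- The maps driving the second cluster contract a neighbourhood of the fixed point. -/
lemma exists_contraction {f : Circ → Circ} {F : ℝ → ℝ} (hF : IsC2Lift f F) (hf0 : f 0 = 0)
    {φ : Circ → ℝ} (hφ : IsC2 φ) (hφ0 : φ 0 = 0) {α m : ℝ}
    (hα : |deriv F 0 * (1 + α * m * deriv (fun t : ℝ => φ (t : Circ)) 0)| < 1) :
    ∃ κ d R, 0 ≤ κ ∧ κ < 1 ∧ 0 < d ∧ 0 < R ∧ ∀ a, |a - m| ≤ d → ∀ x : Circ, ‖x‖ ≤ R →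
      ‖f (x + ((α * a * φ x : ℝ) : Circ))‖ ≤ κ * ‖x‖ := by
  set p : ℝ → ℝ := fun t => φ (t : Circ) with hp
  have hp0 : p 0 = 0 := by simpa [hp] using hφ0
  have hpd : Differentiable ℝ p := hφ.differentiable (by norm_num)
  have hpc : Continuous (deriv p) := hφ.continuous_deriv (by norm_num)
  have hFd : Differentiable ℝ F := hF.1.differentiable (by norm_num)
  have hFc : Continuous (deriv F) := hF.1.continuous_deriv (by norm_num)
  have hpcont := hpd.continuous
  obtain ⟨κ, hκ, hκ1⟩ := exists_between hα
  have hΦ : Continuous fun q : ℝ × ℝ =>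
      |deriv F (q.2 + α * q.1 * p q.2) * (1 + α * q.1 * deriv p q.2)| := by fun_prop
  -- The derivative of the driving map is jointly continuous in the mean `a` and the point, so
  -- contraction persists for means near `m`.
  have hev : ∀ᶠ q in 𝓝 (m, (0 : ℝ)),
      |deriv F (q.2 + α * q.1 * p q.2) * (1 + α * q.1 * deriv p q.2)| < κ := by
    refine hΦ.continuousAt.eventually_lt_const ?_
    simpa [hp0] using hκ
  obtain ⟨δ, hδ, hδ'⟩ := Metric.eventually_nhds_iff.1 hev
  refine ⟨κ, δ / 2, δ / 2, (abs_nonneg _).trans hκ.le, hκ1, by positivity, by positivity,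
    fun a ha x hx => ?_⟩
  obtain ⟨t, rfl, ht⟩ := exists_coe_eq_abs_eq_norm x
  set T : ℝ → ℝ := fun t => F (t + α * a * p t) with hT
  have hTd : ∀ s, HasDerivAt T (deriv F (s + α * a * p s) * (1 + α * a * deriv p s)) s := fun s =>
    (hFd (s + α * a * p s)).hasDerivAt.comp s
      ((hasDerivAt_id s).add ((hpd s).hasDerivAt.const_mul (α * a)))
  have hmv : ‖T t - T 0‖ ≤ κ * ‖t - 0‖ := by
    refine (convex_closedBall (0 : ℝ) (δ / 2)).norm_image_sub_le_of_norm_hasDerivWithin_le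
      (fun s _ => (hTd s).hasDerivWithinAt) (fun s hs => ?_)
      (Metric.mem_closedBall_self (by positivity)) ?_
    · have hs' : |s| ≤ δ / 2 := by simpa using hs
      refine (hδ' (y := (a, s)) ?_).le
      rw [Prod.dist_eq, Real.dist_eq, Real.dist_eq, sub_zero]
      exact max_lt (by linarith) (by linarith)
    · simpa [ht] using hx
  -- The lift need only send 0 to an integer; subtracting `T 0` gives a small real representative.
  have hT0 : ((T 0 : ℝ) : Circ) = 0 := by
    simp only [hT, hp0, mul_zero, add_zero]
    rw [← hF.2]
    exact hf0
  have hfT : f ((t : Circ) + ((α * a * φ t : ℝ) : Circ)) = ((T t - T 0 : ℝ) : Circ) := by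
    rw [AddCircle.coe_sub, hT0, sub_zero, ← AddCircle.coe_add, hF.2]
  rw [hfT, ← ht]
  refine (norm_coe_circ_le _).trans ?_
  simpa using hmv

lemma dW_self (μ : Measure Circ) : dW μ μ = 0 := by simp [dW]

/-- A test function may be replaced by `g - g 0`, which is at most `ρ` in absolute value on the ball
carrying `ν`. -/
lemma dW_dirac_le {ν : Measure Circ} [IsProbabilityMeasure ν] {ρ : ℝ}
    (h : ν (Metric.closedBall 0 ρ)ᶜ = 0) : dW ν (Measure.dirac 0) ≤ ENNReal.ofReal ρ := by
  refine iSup₂_le fun g hg => ENNReal.ofReal_le_ofReal ?_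
  have hi := integrable_of_continuous hg.continuous ν
  have hb : ∀ᵐ x ∂ν, ‖g x - g 0‖ ≤ ρ := by
    have hmem : ∀ᵐ x ∂ν, x ∈ Metric.closedBall (0 : Circ) ρ := h
    filter_upwards [hmem] with x hx
    have := hg.dist_le_mul x 0
    rw [NNReal.coe_one, one_mul, dist_eq_norm] at this
    exact this.trans hx
  have h1 : ∫ x, g x ∂ν - ∫ x, g x ∂(Measure.dirac 0) = ∫ x, (g x - g 0) ∂ν := by
    rw [integral_dirac, integral_sub hi (integrable_const _)]
    simp
  rw [h1]
  exact (le_abs_self _).trans (by simpa using norm_integral_le_of_norm_le_const hb)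

lemma dWSet_le {s : State} [IsProbabilityMeasure s.1] [IsProbabilityMeasure s.2] {ρ : ℝ}
    (h : s.2 (Metric.closedBall 0 ρ)ᶜ = 0) :
    s.dWSet (partiallySynchronized {0}) ≤ ENNReal.ofReal ρ := by
  refine (iInf₂_le (s.1, Measure.dirac 0) ⟨inferInstance, 0, rfl, rfl⟩).trans ?_
  rw [State.dW, dW_self]
  exact max_le zero_le (dW_dirac_le h)

lemma measure_compl_closedBall_of_support {ν : Measure Circ} {R : ℝ}
    (h : ν.support ⊆ Metric.thickening R {0}) : ν (Metric.closedBall 0 R)ᶜ = 0 := by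
  refine measure_mono_null (compl_subset_compl.2 (h.trans fun x hx => ?_))
    ν.measure_compl_support
  rw [Metric.thickening_singleton] at hx
  exact Metric.ball_subset_closedBall hx

end ClusterSync

/-! ### Choice of constants and conclusion. -/

open ClusterSync in
theorem mainTheorem6
    (f : ClusterSync.Circ → ClusterSync.Circ) (F : ℝ → ℝ) (hF : ClusterSync.IsC2Lift f F)
    (σ : ℝ) (hσ : 1 < σ) (hexp : ∀ t : ℝ, σ ≤ |deriv F t|) (hf0 : f 0 = 0)
    (μbar : Measure ClusterSync.Circ) (hprob : IsProbabilityMeasure μbar)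
    (hac : μbar ≪ volume) (hinv : μbar.map f = μbar)
    (φ ψ : ClusterSync.Circ → ℝ) (hφ : ClusterSync.IsC2 φ) (hψ : ClusterSync.IsC2 ψ)
    (hφ0 : φ 0 = 0) (α : ℝ)
    (hα : |deriv F 0 *
      (1 + α * (∫ y, ψ y ∂μbar) * deriv (fun t : ℝ => φ (t : ClusterSync.Circ)) 0)| < 1) :
    ∃ K₀ > 0, ∃ δ₁ > 0, ∃ η > 0, ∃ R > 0,
      ∀ h₁₁ h₁₂ : ClusterSync.Circ → ClusterSync.Circ → ℝ,
        ClusterSync.IsC2₂ h₁₁ → ClusterSync.IsC2₂ h₁₂ →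
        (∀ y, h₁₁ 0 y = 0) → (∀ y, h₁₂ 0 y = 0) →
        ∀ K ≥ K₀, ∀ δ : ℝ, 0 < δ → δ ≤ δ₁ →
          ∃ ε₀ > 0, ∀ ε : ℝ, |ε| < ε₀ →
            ClusterSync.IsStableWith
              (ClusterSync.perturbedExample f φ ψ α h₁₁ h₁₂ ε) {0}
              (ClusterSync.c1Ball μbar K (δ / 2)) η R (μbar, Measure.dirac 0) ∧
            ∀ μ ν : Measure ClusterSync.Circ, IsProbabilityMeasure ν →
              μ ∈ ClusterSync.c1Ball μbar K (δ / 2) →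
              ∀ n : ℕ,
                ((ClusterSync.perturbedExample f φ ψ α h₁₁ h₁₂ ε).step^[n] (μ, ν)).1 ∈
                  ClusterSync.c1Ball μbar K δ := by
  obtain ⟨c, C, D, hcF, hb, hn, hD⟩ := exists_cover hF (zero_lt_one.trans hσ) hexp
  have hf : ∀ t : ℝ, f (t : Circ) = ((c.map t : ℝ) : Circ) := fun t => by rw [hcF, hF.2]
  have hfc : Continuous f := c.continuous_of_lift hf
  obtain ⟨Kr, r, hr, hPr⟩ := hb.exists_invariant hσ hn hD
  obtain rfl := hb.eq_meas_of_invariant hσ hn hD hr hPr hf hac hinv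
  obtain ⟨κ, d, R, hκ0, hκ1, hd, hR, hcontr⟩ := exists_contraction hF hf0 hφ hφ0 hα
  have hψc : Continuous ψ := continuous_circ_iff.2 hψ.continuous
  have hφc : Continuous φ := continuous_circ_iff.2 hφ.continuous
  obtain ⟨M, hM, hMψ⟩ := exists_bound_of_periodic hψ.continuous (periodic_coe_circ ψ)
  have hl1 : 0 < 1 - σ⁻¹ := sub_pos.2 (inv_lt_one_of_one_lt₀ hσ)
  set V₀ := max (max 1 Kr) (2 * C / (1 - σ⁻¹)) with hV₀
  have hV₀1 : 1 ≤ V₀ := (le_max_left _ _).trans (le_max_left _ _)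
  -- The strong norm of a probability density is 1 plus its variation. An `L¹` error below `d / M`
  -- changes the mean of `ψ` by at most `d`.
  refine ⟨1 + V₀, by linarith, d / M, by positivity, 1, one_pos, R, hR,
    fun h₁₁ h₁₂ hh₁ hh₂ _ _ K hK δ hδ hδ₁ => ?_⟩
  set V := K - 1 with hV
  have hVV : V₀ ≤ V := by linarith
  have hV1 : 1 ≤ V := hV₀1.trans hVV
  have hrV : Dens V r := hr.mono (((le_max_right _ _).trans (le_max_left _ _)).trans hVV)
  have hVC : 2 * C ≤ (1 - σ⁻¹) * V := by
    have h1 : 2 * C / (1 - σ⁻¹) ≤ V := (le_max_right _ _).trans hVV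
    rw [div_le_iff₀ hl1] at h1
    linarith
  obtain ⟨θ, A, hθ0, hθ1, hA, hdec⟩ := hb.exists_l1_decay hσ hn hD V
  have hθpos : 0 < θ := (inv_pos.2 hb.pos).trans hθ0
  obtain ⟨N, hN⟩ : ∃ N : ℕ, A * θ ^ N < δ / 4 := by
    have h1 := (tendsto_pow_atTop_nhds_zero_of_lt_one hθpos.le hθ1).const_mul A
    rw [mul_zero] at h1
    exact (h1.eventually_lt_const (show 0 < δ / 4 by positivity)).exists
  obtain ⟨B, hB, hnear⟩ := exists_nearId_of_interaction hh₁ hh₂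
  -- The three terms ensure, in turn, an invertible near-identity map, invariance of the class `V`,
  -- and total error below `δ / 4` over `N` steps.
  set e₀ := min (min (1 / 2) ((1 - σ⁻¹) / 12)) (δ / (4 * (N + 1) * (4 * V + 2))) with he₀
  have hVpos : 0 < 4 * V + 2 := by linarith
  have he₀pos : 0 < e₀ := by positivity
  refine ⟨e₀ / B, by positivity, fun ε hε => ?_⟩
  set net := perturbedExample f φ ψ α h₁₁ h₁₂ ε with hnet
  have he : |ε| * B < e₀ := (lt_div_iff₀ hB).1 hε
  have he1 : |ε| * B ≤ 1 / 2 := he.le.trans ((min_le_left _ _).trans (min_le_left _ _))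
  have he2 : 12 * (|ε| * B) ≤ 1 - σ⁻¹ := by
    have := he.le.trans ((min_le_left _ _).trans (min_le_right _ _))
    linarith
  set E := |ε| * B * (4 * V + 2) with hE
  have hE0 : 0 ≤ E := by positivity
  have hNE : N * E < δ / 4 := by
    have h1 := he.trans_le (min_le_right _ _)
    rw [lt_div_iff₀ (by positivity)] at h1
    have h2 : (N + 1) * E < δ / 4 := by rw [hE]; linarith
    linarith
  have hmap₂ : ∀ s : State, Continuous (net.map₂ s) := fun s => by
    rw [funext (perturbedExample_map₂ f φ ψ α h₁₁ h₁₂ ε s)]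
    exact hfc.comp (continuous_id.add (continuous_coe_circ.comp (continuous_const.mul hφc)))
  -- Stated on a subtype so that `choose` yields a self-map whose iterates form the orbit of
  -- densities.
  have hstep : ∀ p : {p : (ℝ → ℝ) × Measure Circ // Dens V p.1 ∧ IsProbabilityMeasure p.2},
      ∃ q : {p : (ℝ → ℝ) × Measure Circ // Dens V p.1 ∧ IsProbabilityMeasure p.2},
        net.step (meas p.1.1, p.1.2) = (meas q.1.1, q.1.2) ∧
        l1 (fun t => q.1.1 t - c.transfer p.1.1 t) ≤ E := by
    rintro ⟨⟨u, ν⟩, hu, hν⟩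
    simp only at hu hν ⊢
    obtain ⟨b, hbe, hbm⟩ := hnear ε he1 (meas u) ν hu.isProbabilityMeasure hν
    refine ⟨⟨(c.transfer (b.transfer u), ν.map (net.map₂ (meas u, ν))),
      hb.dens_perturbed hσ hbe he1 he2 hV1 hVC hu,
      Measure.isProbabilityMeasure_map (hmap₂ _).measurable.aemeasurable⟩, ?_,
      c.l1_perturbed_sub_le hbe he1 hu⟩
    refine Prod.ext ?_ rfl
    have hbu := hbe.bounds.dens_transfer hu
    set g : Circ → Circ := fun x =>
      x + ((ε * (∫ y, h₁₁ x y ∂(meas u) + ∫ y, h₁₂ x y ∂ν) : ℝ) : Circ) with hg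
    have hgb : ∀ t : ℝ, g (t : Circ) = ((b.map t : ℝ) : Circ) := fun t => (hbm t).symm
    have h1 : net.map₁ (meas u, ν) = f ∘ g :=
      funext (perturbedExample_map₁ f φ ψ α h₁₁ h₁₂ ε (meas u, ν))
    simp only [Network.step]
    rw [h1, ← Measure.map_map hfc.measurable (b.continuous_of_lift hgb).measurable,
      b.map_meas hgb hu hbu, c.map_meas hf hbu (hb.dens_transfer hbu)]
  choose next hnext₁ hnext₂ using hstep
  have orbit : ∀ μ ν : Measure Circ, IsProbabilityMeasure ν → μ ∈ c1Ball (meas r) K (δ / 2) →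
      ∃ (u : ℕ → ℝ → ℝ) (νs : ℕ → Measure Circ), νs 0 = ν ∧
        (∀ n, Dens V (u n)) ∧ (∀ n, IsProbabilityMeasure (νs n)) ∧
        (∀ n, net.step^[n] (μ, ν) = (meas (u n), νs n)) ∧
        ∀ n, l1 (fun t => u n t - r t) < δ := by
    intro μ ν hν hμ
    obtain ⟨u₀, hu₀, rfl, hu₀r⟩ := (mem_c1Ball_iff hr).1 hμ
    set p := fun n => next^[n] ⟨(u₀, ν), hu₀, hν⟩ with hp
    have hps : ∀ n, p (n + 1) = next (p n) := fun n => Function.iterate_succ_apply' _ _ _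
    refine ⟨fun n => (p n).1.1, fun n => (p n).1.2, rfl, fun n => (p n).2.1, fun n => (p n).2.2,
      fun n => ?_, c.l1_pseudoOrbit_lt hr.c1 hPr (fun n => (p n).2.1.c1) hE0 (fun n => ?_) hNE
      (fun n => ?_) hu₀r⟩
    · induction n with
      | zero => rfl
      | succ n ih => rw [Function.iterate_succ_apply', ih, hnext₁, ← hps]
    · rw [hps]
      exact hnext₂ _
    · have h1 := hdec N _ r (p n).2.1 hrV
      rw [Function.iterate_fixed hPr] at h1
      exact h1.trans hN.le
  refine ⟨⟨one_pos, hR, ⟨hprob, 0, rfl, rfl⟩, (mem_c1Ball_iff hr).2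
    ⟨r, hrV, rfl, by simpa [l1] using hδ⟩, fun μ ν _ hν hμ _ hsupp => ?_⟩,
    fun μ ν hν hμ n => ?_⟩
  · obtain ⟨u, νs, hν0, hu, hνs, hstep, hclose⟩ := orbit μ ν hν hμ
    -- The driving map changes with `n`, but all the maps share the same `κ` and `R` because the
    -- first cluster stays `δ`-close.
    have hball : ∀ n, νs n (Metric.closedBall 0 (κ ^ n * R))ᶜ = 0 := by
      intro n
      induction n with
      | zero => simpa [hν0] using measure_compl_closedBall_of_support hsupp
      | succ n ih =>
        have h1 := hstep (n + 1)
        rw [Function.iterate_succ_apply', hstep n] at h1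
        have h2 : νs (n + 1) = (νs n).map (net.map₂ (meas (u n), νs n)) := (congrArg Prod.snd h1).symm
        rw [h2, Measure.map_apply (hmap₂ _).measurable Metric.isClosed_closedBall.measurableSet.compl]
        refine measure_mono_null (fun x hx => ?_) ih
        rw [mem_compl_iff]
        refine fun hxn => hx ?_
        have hxn' : ‖x‖ ≤ κ ^ n * R := by simpa using hxn
        have hmean : |∫ y, ψ y ∂(meas (u n)) - ∫ y, ψ y ∂(meas r)| ≤ d := by
          refine (abs_integral_meas_sub_le (hu n) hr hψc hMψ).trans
            ((mul_le_mul_of_nonneg_left (hclose n).le hM.le).trans ?_)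
          rwa [le_div_iff₀ hM, mul_comm] at hδ₁
        have h3 := hcontr _ hmean x (hxn'.trans (mul_le_of_le_one_left hR.le
          (pow_le_one₀ hκ0 hκ1.le)))
        rw [mem_closedBall_zero_iff, hnet, perturbedExample_map₂]
        refine h3.trans ?_
        rw [pow_succ', mul_assoc]
        exact mul_le_mul_of_nonneg_left hxn' hκ0
    have hlim : Tendsto (fun n => ENNReal.ofReal (κ ^ n * R)) atTop (𝓝 0) := by
      have h1 := (tendsto_pow_atTop_nhds_zero_of_lt_one hκ0 hκ1).mul_const R
      rw [zero_mul] at h1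
      simpa using ENNReal.tendsto_ofReal h1
    refine tendsto_of_tendsto_of_tendsto_of_le_of_le tendsto_const_nhds hlim
      (fun n => zero_le) fun n => ?_
    simp only [hstep]
    have := (hu n).isProbabilityMeasure
    have := hνs n
    exact dWSet_le (s := (meas (u n), νs n)) (hball n)
  · obtain ⟨u, νs, -, hu, -, hstep, hclose⟩ := orbit μ ν hν hμ
    rw [hstep]
    exact (mem_c1Ball_iff hr).2 ⟨u n, hu n, rfl, hclose n⟩
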